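/- **Setting.** Let $M\ge 1$ be the number of devices and $L$ the packet length. Let $0=\tau_1<\tau_2<\dots<\tau_M<\tau_{M+1}=T$ be the time offsets, $d_k=\tau_{k+1}-\tau_k$, let $h=(h_1,\dots,h_M)\in\mathbb{C}^M$ be the residual channel gains and $N_0>0$. For a packet $x_m[i]\in\mathbb{C}$ ($1\le m\le M$, $1\le i\le L$) let $\widehat{\mathbb{E}}_m=\frac1L\sum_i x_m[i]$ and $\widehat{\mathbb{D}}_m=\frac1L\sum_i|x_m[i]-\widehat{\mathbb{E}}_m|^2$ be the sample mean and the sample variance, and assume $\widehat{\mathbb{D}}_m>0$ for all $m$. Write $\mathcal{CN}(\mu,v)$ for the law of a complex variable whose real and imaginary parts are independent $\mathcal{N}(\mathrm{Re}\,\mu,\frac v2)$ and $\mathcal{N}(\mathrm{Im}\,\mu,\frac v2)$. Let the random variables $s_m[i]\sim\mathcal{CN}(\widehat{\mathbb{E}}_m,\widehat{\mathbb{D}}_m)$ ($1\le i\le L$) and $z_k[i]\sim\mathcal{CN}(0,N_0/d_k)$ ($1\le k\le M$, $1\le i\le L+1$) all be independent, and let $$y_k[i]=\sum_{m\le k}h_ms_m[i]+\sum_{m>k}h_ms_m[i-1]+z_k[i],\qquad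 1\le k\le M,\ 1\le i\le L+1,\qquad s_m[0]=s_m[L+1]=0 .$$ Let $y$ be the vector of all these samples and $s[i]=(s_1[i],\dots,s_M[i])$. Complex vectors are identified with real ones by listing all real parts ($\mathfrak{r}$) and then all imaginary parts ($\mathfrak{i}$). **Algorithm.** A message in $2M$ real variables is a pair $(\eta,\Lambda)$ that stands for $w\mapsto\exp(-\frac12w^\top\Lambda w+w^\top\eta)$; products of messages add the pairs; its moment parameters are $\Sigma=\Lambda^\dagger$, $\mu=\Lambda^\dagger\eta$, and conversely $\Lambda=\Sigma^\dagger$, $\eta=\Sigma^\dagger\mu$ ($\dagger$ is the Moore–Penrose inverse). The variables are $W_{k,i}=(s_1[i],\dots,s_k[i],s_{k+1}[i-1],\dots,s_M[i-1])$, arranged in the chain $W_{1,1},\dots,W_{M,1},W_{1,2},\dots,W_{M,L+1}$; two consecutive ones differ in exactly one symbol position, namely the position $k$ if the later one is $W_{k,i}$. Let $\beta_1,\beta_2\in\mathbb{R}^{M\times2}$ have the rows $(h_m^{\mathfrak r},h_m^{\mathfrak i})$ and $(-h_m^{\mathfrak i},h_m^{\mathfrak r})$. 1. The sample message $f_b$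 at $W_{k,i}$ is $$\eta_b=\tfrac{2d_k}{N_0}\begin{bmatrix}\beta_1\\ \beta_2\end{bmatrix}\begin{bmatrix}y_k[i]^{\mathfrak r}\\ y_k[i]^{\mathfrak i}\end{bmatrix}\circ\gamma,\qquad \Lambda_b=\tfrac{2d_k}{N_0}\begin{bmatrix}\beta_1\beta_1^\top&\beta_1\beta_2^\top\\ \beta_2\beta_1^\top&\beta_1\beta_1^\top\end{bmatrix}\circ\gamma\gamma^\top,$$ with $\circ$ the entrywise product, where $\gamma$ is the $0$/$1$ indicator of the coordinates of the symbols $m\le k$ if $i=1$, of the symbols $m>k$ if $i=L+1$, and of all symbols otherwise. 2. The prior message $f_t$ at $W_{k,i}$ has, if $k=M$, mean $(\widehat{\mathbb E}^{\mathfrak r},\widehat{\mathbb E}^{\mathfrak i})$ and covariance $\frac12\mathrm{diag}(\widehat{\mathbb D},\widehat{\mathbb D})$, where $\widehat{\mathbb E}=(\widehat{\mathbb E}_1,\dots,\widehat{\mathbb E}_M)$ and $\widehat{\mathbb D}=(\widehat{\mathbb D}_1,\dots,\widehat{\mathbb D}_M)$; it is constant ($\eta=0$, $\Lambda=0$) if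 $k\neq M$. 3. Forward pass, from left to right: $f_\ell$ is constant at $W_{1,1}$; at every later variable it is the product $f_bf_tf_\ell$ of its left neighbour, in whose moment parameters the two entries of $\mu$, and the two rows and the two columns of $\Sigma$, that belong to the differing symbol are deleted and replaced by zeros. 4. Backward pass, from right to left: $f_r'$ is constant at $W_{M,L+1}$; at every earlier variable it is the product $f_bf_tf_r'$ of its right neighbour, with the same replacement. 5. Marginalization: for $1\le i\le L$ let $(\mu_{s[i]},\Sigma_{s[i]})$ be the moment parameters of the product $f_bf_tf_\ell f_r'$ at $W_{M,i}=s[i]$. **Theorem.** For every $1\le i\le L$: 1. The posterior (conditional) distribution of $s[i]$ given $y$ is an $M$-dimensional complex Gaussian distribution, that is, the Gaussian distribution on $\mathbb{R}^{2M}$ with mean $\mu_{s[i]}=\begin{bmatrix}\mu^{\mathfrak r}_{s[i]}\\ \mu^{\mathfrak i}_{s[i]}\end{bmatrix}$ and positive definite covariance matrix $\Sigma_{s[i]}=\begin{bmatrix}\Sigma^{\mathfrak{rr}}_{s[i]}&\Sigma^{\mathfrak{ri}}_{s[i]}\\ \Sigma^{\mathfrak{ir}}_{s[i]}&\Sigma^{\mathfrak{ii}}_{s[i]}\end{bmatrix}$,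 where $(\mu_{s[i]},\Sigma_{s[i]})$ is the output of the algorithm for the observed samples $y$. 2. The posterior distribution of $s_+[i]=\sum_{m=1}^Ms_m[i]$ given $y$ is a complex Gaussian distribution, that is, the Gaussian distribution on $\mathbb{R}^2$ with mean $\begin{bmatrix}\mathbf 1^\top\mu^{\mathfrak r}_{s[i]}\\ \mathbf 1^\top\mu^{\mathfrak i}_{s[i]}\end{bmatrix}$ and positive definite covariance matrix $\begin{bmatrix}\mathbf 1^\top\Sigma^{\mathfrak{rr}}_{s[i]}\mathbf 1&\mathbf 1^\top\Sigma^{\mathfrak{ri}}_{s[i]}\mathbf 1\\ \mathbf 1^\top\Sigma^{\mathfrak{ir}}_{s[i]}\mathbf 1&\mathbf 1^\top\Sigma^{\mathfrak{ii}}_{s[i]}\mathbf 1\end{bmatrix}$. (As usual, conditional distributions given $y$ are determined for almost every value of $y$.) -/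

import Mathlib

open MeasureTheory ProbabilityTheory
open scoped Matrix

namespace OAC

noncomputable section

/-! ### Sample moments, complex Gaussian laws, and the sampled channel -/

/-- First sample moment of the packet of device `m`. -/
def sampleMean {M L : ℕ} (x : Fin L → Fin M → ℂ) (m : Fin M) : ℂ :=
  (1 / (L : ℂ)) * ∑ i, x i m

/-- Sample variance of the packet of device `m`. -/
def sampleVar {M L : ℕ} (x : Fin L → Fin M → ℂ) (m : Fin M) : ℝ :=
  (1 / (L : ℝ)) * ∑ i, ‖x i m - sampleMean x m‖ ^ 2

/-- The circularly symmetric complex Gaussian law with mean `μ` and variance `v`: the real and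
imaginary parts are independent real Gaussians with variance `v / 2` each. -/
def complexGaussian (μ : ℂ) (v : ℝ) : Measure ℂ :=
  ((gaussianReal μ.re (v / 2).toNNReal).prod (gaussianReal μ.im (v / 2).toNNReal)).map
    Complex.measurableEquivRealProd.symm

/-- The symbol `s_m[t]` with the time index `t` counted from one, extended by
`s_m[0] = s_m[L+1] = 0`. -/
def symbolAt {M L : ℕ} (s : Fin L → Fin M → ℂ) (t : ℕ) (m : Fin M) : ℂ :=
  if ht : 1 ≤ t ∧ t ≤ L then s ⟨t - 1, by omega⟩ m else 0

/-- The `m`-th entry of the neighbour symbols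
`(s_1[i], …, s_k[i], s_{k+1}[i-1], …, s_M[i-1])` of the sample `y_k[i]`.
In `Fin` the indices are counted from zero, so time `i` is `(i : ℕ) + 1` here. -/
def neighbour {M L : ℕ} (s : Fin L → Fin M → ℂ) (i : Fin (L + 1)) (k m : Fin M) : ℂ :=
  symbolAt s (if m ≤ k then (i : ℕ) + 1 else (i : ℕ)) m

/-- The length `d_k = τ_{k+1} - τ_k` of the `k`-th matched filter. -/
def filterLength {M : ℕ} (τ : Fin (M + 1) → ℝ) (k : Fin M) : ℝ :=
  τ k.succ - τ k.castSucc

/-- The real vector `(Re w, Im w)` of a complex vector `w`. -/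
def realVec {ι : Type*} (w : ι → ℂ) : EuclideanSpace ℝ (ι ⊕ ι) :=
  WithLp.toLp 2 (Sum.elim (fun m => (w m).re) (fun m => (w m).im))

/-! ### Moore-Penrose pseudoinverse -/

/-- `B` is the Moore-Penrose pseudoinverse of the real square matrix `A`. -/
structure IsMoorePenrose {n : Type*} [Fintype n] (A B : Matrix n n ℝ) : Prop where
  mul_mul_left : A * B * A = A
  mul_mul_right : B * A * B = B
  symm_left : (A * B)ᵀ = A * B
  symm_right : (B * A)ᵀ = B * A

theorem IsMoorePenrose.unique {n : Type*} [Fintype n] {A B C : Matrix n n ℝ}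
    (hB : IsMoorePenrose A B) (hC : IsMoorePenrose A C) : B = C := by
  have h1 : A * B = A * C := by
    calc A * B = (A * B)ᵀ := hB.symm_left.symm
      _ = (A * C * (A * B))ᵀ := by rw [← mul_assoc, hC.mul_mul_left]
      _ = A * B * (A * C) := by rw [Matrix.transpose_mul, hB.symm_left, hC.symm_left]
      _ = A * C := by rw [← mul_assoc, hB.mul_mul_left]
  have h2 : B * A = C * A := by
    calc B * A = (B * A)ᵀ := hB.symm_right.symm
      _ = (B * A * (C * A))ᵀ := by
          rw [mul_assoc, ← mul_assoc A C A, hC.mul_mul_left]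
      _ = C * A * (B * A) := by rw [Matrix.transpose_mul, hB.symm_right, hC.symm_right]
      _ = C * A := by rw [mul_assoc, ← mul_assoc A B A, hB.mul_mul_left]
  calc B = B * A * B := hB.mul_mul_right.symm
    _ = C * (A * B) := by rw [h2, mul_assoc]
    _ = C := by rw [h1, ← mul_assoc, hC.mul_mul_right]

open Classical in
/-- The Moore-Penrose pseudoinverse `A†` of a real square matrix. -/
def pinv {n : Type*} [Fintype n] (A : Matrix n n ℝ) : Matrix n n ℝ :=
  if h : ∃ B, IsMoorePenrose A B then h.choose else 0

/-! ### Gaussian messages -/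

/-- The canonical parameters `(η, Λ)` of the message `exp (-½ wᵀ Λ w + wᵀ η)` in the
`2M` real variables `w = (b^𝔯_1, …, b^𝔯_M, b^𝔦_1, …, b^𝔦_M)`. -/
structure Message (M : ℕ) where
  eta : Fin M ⊕ Fin M → ℝ
  prec : Matrix (Fin M ⊕ Fin M) (Fin M ⊕ Fin M) ℝ

/-- The constant message. -/
def Message.flat (M : ℕ) : Message M := ⟨0, 0⟩

/-- The product of two messages: the canonical parameters add up. -/
def Message.prod {M : ℕ} (a b : Message M) : Message M :=
  ⟨a.eta + b.eta, a.prec + b.prec⟩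

/-- The covariance matrix `Σ = Λ†` of a message. -/
def Message.cov {M : ℕ} (a : Message M) : Matrix (Fin M ⊕ Fin M) (Fin M ⊕ Fin M) ℝ :=
  pinv a.prec

/-- The mean vector `μ = Λ† η` of a message. -/
def Message.mean {M : ℕ} (a : Message M) : Fin M ⊕ Fin M → ℝ :=
  a.cov *ᵥ a.eta

/-- The message with the moment parameters `(μ, Σ)`, that is, `Λ = Σ†` and `η = Σ† μ`. -/
def Message.ofMoments {M : ℕ} (μ : Fin M ⊕ Fin M → ℝ)
    (S : Matrix (Fin M ⊕ Fin M) (Fin M ⊕ Fin M) ℝ) : Message M :=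
  ⟨pinv S *ᵥ μ, pinv S⟩

/-- The real coordinate `a` belongs to the complex symbol number `j`. -/
def ofSymbol {M : ℕ} (j : Fin M) (a : Fin M ⊕ Fin M) : Prop :=
  a = Sum.inl j ∨ a = Sum.inr j

open Classical in
/-- Passing a message through a compatibility function whose two sides differ in the `j`-th symbol:
in the moment parameters the two entries (rows and columns) of the old `j`-th symbol are deleted,
and two zero entries (rows and columns) are inserted for the new `j`-th symbol. -/
def Message.replaceSymbol {M : ℕ} (j : Fin M) (a : Message M) : Message M :=
  Message.ofMoments
    (fun p => if ofSymbol j p then 0 else a.mean p)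
    (Matrix.of fun p q => if ofSymbol j p ∨ ofSymbol j q then 0 else a.cov p q)

/-! ### The messages of the factor graph and the forward/backward passes -/

/-- The `M × 2` matrix with rows `(h^𝔯_m, h^𝔦_m)`. -/
def beta₁ {M : ℕ} (h : Fin M → ℂ) : Matrix (Fin M) (Fin 2) ℝ :=
  Matrix.of fun m => ![(h m).re, (h m).im]

/-- The `M × 2` matrix with rows `(-h^𝔦_m, h^𝔯_m)`. -/
def beta₂ {M : ℕ} (h : Fin M → ℂ) : Matrix (Fin M) (Fin 2) ℝ :=
  Matrix.of fun m => ![-(h m).im, (h m).re]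

/-- The indicator of the symbols that are present in the sample `y_k[i]`: the first `k` symbols for
the first time index, the last `M - k` symbols for the last one, and all symbols otherwise. -/
def present {M L : ℕ} (i : Fin (L + 1)) (k m : Fin M) : ℝ :=
  if (i : ℕ) = 0 then (if m ≤ k then 1 else 0)
  else if (i : ℕ) = L then (if k < m then 1 else 0)
  else 1

/-- The indicator vector `γ` on the `2M` real coordinates. -/
def gammaVec {M L : ℕ} (i : Fin (L + 1)) (k : Fin M) : Fin M ⊕ Fin M → ℝ :=
  Sum.elim (present i k) (present i k)

/-- The indicator matrix `Γ` on the `2M` real coordinates. -/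
def gammaMat {M L : ℕ} (i : Fin (L + 1)) (k : Fin M) :
    Matrix (Fin M ⊕ Fin M) (Fin M ⊕ Fin M) ℝ :=
  Matrix.vecMulVec (gammaVec i k) (gammaVec i k)

/-- The message `f_b` from the bottom: the information in the sample `y_k[i]`. -/
def bottomMessage {M L : ℕ} (N₀ : ℝ) (d : Fin M → ℝ) (h : Fin M → ℂ)
    (y : Fin (L + 1) → Fin M → ℂ) (i : Fin (L + 1)) (k : Fin M) : Message M where
  eta := ((2 * d k / N₀) •
      Sum.elim (beta₁ h *ᵥ ![(y i k).re, (y i k).im]) (beta₂ h *ᵥ ![(y i k).re, (y i k).im]))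
    * gammaVec i k
  prec := ((2 * d k / N₀) •
      Matrix.fromBlocks (beta₁ h * (beta₁ h)ᵀ) (beta₁ h * (beta₂ h)ᵀ)
        (beta₂ h * (beta₁ h)ᵀ) (beta₁ h * (beta₁ h)ᵀ))
    ⊙ gammaMat i k

/-- The message `f_t` from the top: the prior information, added once every `M` samples, at
`k = M`. -/
def topMessage {M : ℕ} (E : Fin M → ℂ) (D : Fin M → ℝ) (k : Fin M) : Message M :=
  if (k : ℕ) + 1 = M then
    Message.ofMoments (Sum.elim (fun m => (E m).re) (fun m => (E m).im))
      ((1 / 2 : ℝ) • Matrix.diagonal (Sum.elim D D))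
  else Message.flat M

/-- The chain of the variables `W_{1,1}, …, W_{M,1}, W_{1,2}, …, W_{M,L+1}` is numbered by
`n = 0, 1, …, M (L + 1) - 1`. This is the (zero-based) device index `k` of the `n`-th one. -/
def nodeDevice (M : ℕ) [NeZero M] (n : ℕ) : Fin M := Fin.ofNat M (n % M)

/-- The (zero-based) time index `i` of the `n`-th variable of the chain. -/
def nodeTime (M L : ℕ) (n : ℕ) : Fin (L + 1) := Fin.ofNat (L + 1) (n / M)

/-- The product `f_b f_t` at the `n`-th variable of the chain. -/
def localMessage {M L : ℕ} [NeZero M] (N₀ : ℝ) (d : Fin M → ℝ) (h : Fin M → ℂ) (E : Fin M → ℂ)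
    (D : Fin M → ℝ) (y : Fin (L + 1) → Fin M → ℂ) (n : ℕ) : Message M :=
  (bottomMessage N₀ d h y (nodeTime M L n) (nodeDevice M n)).prod (topMessage E D (nodeDevice M n))

/-- The forward message `f_ℓ` that enters the `n`-th variable of the chain from the left. -/
def forwardMessage {M L : ℕ} [NeZero M] (N₀ : ℝ) (d : Fin M → ℝ) (h : Fin M → ℂ) (E : Fin M → ℂ)
    (D : Fin M → ℝ) (y : Fin (L + 1) → Fin M → ℂ) : ℕ → Message M
  | 0 => Message.flat M
  | n + 1 => Message.replaceSymbol (nodeDevice M (n + 1))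
      ((localMessage N₀ d h E D y n).prod (forwardMessage N₀ d h E D y n))

/-- The backward message `f'_r` that enters from the right the `r`-th variable counted from the
right end of the chain (the rightmost one, `W_{M,L+1}`, is `r = 0`, so that the `r`-th one has
number `M (L + 1) - 1 - r` from the left). -/
def backwardMessage {M L : ℕ} [NeZero M] (N₀ : ℝ) (d : Fin M → ℝ) (h : Fin M → ℂ) (E : Fin M → ℂ)
    (D : Fin M → ℝ) (y : Fin (L + 1) → Fin M → ℂ) : ℕ → Message M
  | 0 => Message.flat M
  | r + 1 => Message.replaceSymbol (nodeDevice M (M * (L + 1) - 1 - r))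
      ((localMessage N₀ d h E D y (M * (L + 1) - 1 - r)).prod (backwardMessage N₀ d h E D y r))

/-- The number in the chain of the variable `W_{M,i} = (s_1[i], …, s_M[i])`. -/
def symbolNode {M L : ℕ} (i : Fin L) : ℕ := M * (i : ℕ) + (M - 1)

/-- The marginalization step: the product `f_b f_t f_ℓ f'_r` at the variable `W_{M,i}`. -/
def marginalMessage {M L : ℕ} [NeZero M] (N₀ : ℝ) (d : Fin M → ℝ) (h : Fin M → ℂ) (E : Fin M → ℂ)
    (D : Fin M → ℝ) (y : Fin (L + 1) → Fin M → ℂ) (i : Fin L) : Message M :=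
  ((localMessage N₀ d h E D y (symbolNode (M := M) i)).prod
    (forwardMessage N₀ d h E D y (symbolNode (M := M) i))).prod
      (backwardMessage N₀ d h E D y (M * (L + 1) - 1 - symbolNode (M := M) i))

/-- The mean vector `μ_{s[i]}` that the message passing computes. -/
def outputMean {M L : ℕ} [NeZero M] (N₀ : ℝ) (d : Fin M → ℝ) (h : Fin M → ℂ) (E : Fin M → ℂ)
    (D : Fin M → ℝ) (y : Fin (L + 1) → Fin M → ℂ) (i : Fin L) : Fin M ⊕ Fin M → ℝ :=
  (marginalMessage N₀ d h E D y i).mean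

/-- The covariance matrix `Σ_{s[i]}` that the message passing computes. -/
def outputCov {M L : ℕ} [NeZero M] (N₀ : ℝ) (d : Fin M → ℝ) (h : Fin M → ℂ) (E : Fin M → ℂ)
    (D : Fin M → ℝ) (y : Fin (L + 1) → Fin M → ℂ) (i : Fin L) :
    Matrix (Fin M ⊕ Fin M) (Fin M ⊕ Fin M) ℝ :=
  (marginalMessage N₀ d h E D y i).cov

/-! ### The moment parameters of the sum of the symbols -/

/-- `(1ᵀ μ^𝔯, 1ᵀ μ^𝔦)`. -/
def sumMean {M : ℕ} (μ : Fin M ⊕ Fin M → ℝ) : Unit ⊕ Unit → ℝ :=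
  Sum.elim (fun _ => 1 ⬝ᵥ (fun m => μ (Sum.inl m))) (fun _ => 1 ⬝ᵥ (fun m => μ (Sum.inr m)))

/-- The matrix of `1ᵀ Σ^𝔯𝔯 1`, `1ᵀ Σ^𝔯𝔦 1`, `1ᵀ Σ^𝔦𝔯 1`, `1ᵀ Σ^𝔦𝔦 1`. -/
def sumCov {M : ℕ} (S : Matrix (Fin M ⊕ Fin M) (Fin M ⊕ Fin M) ℝ) :
    Matrix (Unit ⊕ Unit) (Unit ⊕ Unit) ℝ :=
  Matrix.fromBlocks
    (Matrix.of fun _ _ => 1 ⬝ᵥ (S.toBlocks₁₁ *ᵥ 1)) (Matrix.of fun _ _ => 1 ⬝ᵥ (S.toBlocks₁₂ *ᵥ 1))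
    (Matrix.of fun _ _ => 1 ⬝ᵥ (S.toBlocks₂₁ *ᵥ 1)) (Matrix.of fun _ _ => 1 ⬝ᵥ (S.toBlocks₂₂ *ᵥ 1))

end

end OAC

/-! List the real coordinates of all symbols as `X` and those of all samples as `Y`. Then `Y = H X +
Z` with independent Gaussian components, so given `Y` the vector `X` is Gaussian with precision `J =
diag q + Hᵀ R H` and mean `J⁻¹ η` (`condDistrib_linear_gaussian`, `condDistrib_symbols`). The reason
is regression: with `K = J⁻¹ Hᵀ R` the residual `X - K Y` is uncorrelated with `Y`, hence
independent of it. The symbols of one time index, and their sum, are linear images of `X`. It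
remains to see that the algorithm computes the corresponding part of `J⁻¹ η` and block of `J⁻¹`
(`outputMean_eq_and_outputCov_eq`).

A message is treated as a quadratic form through its gradient `Λ w - η`. On the actual symbols the
gradients of all local forms add up to `J u - η` (`chainGrad_localMessage`). The invariant
`IsMessageOf` says that every value `w` of a variable extends to all symbols so that the gradient of
the forms already collected is the gradient of the message on that variable and zero elsewhere. This
is elimination by stationarity. It survives the steps of the algorithm because the time index of
each symbol position is monotone along the chain (`nodeSlot_mono`): an eliminated symbol never
returns. At the marginal variable the invariant gives a linear equation for `J`; solving it for
every right-hand side yields mean and covariance.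

The other difficulty is degeneracy. Zeros are inserted and `Λ` may be singular, so replacement
through Moore-Penrose inverses is elimination only for messages that are definite on a set of
coordinates and independent of the rest (`PosDefOn`, `Message.GaussianOn`). A sample gives one
complex equation, so it preserves this form if at most one of its effective symbols is still
undetermined; `Message.Enters` records that this is so at every node. A symbol with zero gain may
stay undetermined until the prior arrives. -/

namespace OAC

/-! ### Gaussian regression and conditional laws -/

section GaussianRegression

variable {Ω : Type*} [MeasurableSpace Ω] {P : Measure Ω}

/-- If `V` is independent of `Y`, then given `Y = v` the law of `f Y + V` is the law of `V`
translated by `f v`. -/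
theorem condDistrib_add_of_indepFun [IsProbabilityMeasure P] {β E : Type*}
    [MeasurableSpace β] [MeasurableSpace E] [Add E]
    [MeasurableAdd₂ E] [StandardBorelSpace E] [Nonempty E] {V : Ω → E} {Y : Ω → β}
    (hV : AEMeasurable V P) (hY : AEMeasurable Y P) (hind : IndepFun V Y P) {f : β → E}
    (hf : Measurable f) :
    ∀ᵐ v ∂(P.map Y), condDistrib (fun ω => f (Y ω) + V ω) Y P v
      = (P.map V).map (fun e => f v + e) := by
  have : IsProbabilityMeasure (P.map V) := Measure.isProbabilityMeasure_map hV
  have hg : Measurable (fun p : β × E => f p.1 + p.2) := by fun_prop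
  let κ : Kernel β E := (Kernel.prod Kernel.id (Kernel.const β (P.map V))).map
    (fun p => f p.1 + p.2)
  have hκ : ∀ v, κ v = (P.map V).map (fun e => f v + e) := by
    intro v
    simp only [κ]
    rw [Kernel.map_apply _ hg, Kernel.prod_apply, Kernel.id_apply, Kernel.const_apply,
      Measure.dirac_prod, Measure.map_map hg (by fun_prop)]
    rfl
  have : IsMarkovKernel κ := Kernel.IsMarkovKernel.map _ hg
  have hfY : AEMeasurable (fun ω => f (Y ω)) P := hf.comp_aemeasurable hY
  -- By independence the law of `(Y, V)` is a product; the shear `(v, e) ↦ (v, f v + e)` turns it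
  -- into `P_Y ⊗ κ`, which characterizes the conditional law.
  have key : P.map (fun ω => (Y ω, f (Y ω) + V ω)) = P.map Y ⊗ₘ κ := by
    refine Measure.ext_of_lintegral _ fun φ hφ => ?_
    have h1 : P.map (fun ω => (Y ω, f (Y ω) + V ω))
        = ((P.map Y).prod (P.map V)).map (fun p => (p.1, f p.1 + p.2)) := by
      rw [← hind.symm.map_prod_eq_prod_map_map hY hV,
        AEMeasurable.map_map_of_aemeasurable (by fun_prop) (by fun_prop)]
      rfl
    rw [h1, lintegral_map hφ (by fun_prop), Measure.lintegral_compProd hφ,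
      lintegral_prod _ (by fun_prop)]
    refine lintegral_congr fun v => ?_
    rw [hκ, lintegral_map (g := fun e => f v + e) (by fun_prop) (by fun_prop)]
  filter_upwards [condDistrib_ae_eq_of_measure_eq_compProd Y (by fun_prop) key] with v hv
  rw [hv, hκ]

theorem multivariateGaussian_map_const_add {o : Type*} [Fintype o] [DecidableEq o]
    (a b : EuclideanSpace ℝ o) (S : Matrix o o ℝ) :
    (multivariateGaussian b S).map (fun e => a + e) = multivariateGaussian (a + b) S := by
  rw [multivariateGaussian, multivariateGaussian, Measure.map_map (by fun_prop) (by fun_prop)]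
  simp only [Function.comp_def, add_assoc]

variable {γ o o' : Type*} [Fintype γ] {U : Ω → γ → ℝ}
  {W : Matrix γ γ ℝ}

theorem hasGaussianLaw_mulVec [Fintype o] (hU : HasGaussianLaw U P) (A : Matrix o γ ℝ) :
    HasGaussianLaw (fun ω => A *ᵥ U ω) P :=
  hU.map_fun (Matrix.mulVecLin A).toContinuousLinearMap

theorem covariance_mulVec [IsProbabilityMeasure P] (hU : HasGaussianLaw U P)
    (hW : ∀ c c', cov[fun ω => U ω c, fun ω => U ω c'; P] = W c c')
    (A : Matrix o γ ℝ) (B : Matrix o' γ ℝ) (a : o) (b : o') :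
    cov[fun ω => (A *ᵥ U ω) a, fun ω => (B *ᵥ U ω) b; P] = (A * W * Bᵀ) a b := by
  have h2 : ∀ c, MemLp (fun ω => U ω c) 2 P := fun c =>
    (HasGaussianLaw.eval (X := fun c ω => U ω c) hU c).memLp_two
  simp only [Matrix.mulVec, dotProduct]
  rw [covariance_fun_sum_fun_sum (fun c => (h2 c).const_mul _) (fun c => (h2 c).const_mul _)]
  simp only [covariance_const_mul_left, covariance_const_mul_right, hW, Matrix.mul_apply,
    Matrix.transpose_apply, Finset.sum_mul]
  rw [Finset.sum_comm]
  exact Finset.sum_congr rfl fun _ _ => Finset.sum_congr rfl fun _ _ => by ring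

/-- Both images come from one Gaussian vector, hence are jointly Gaussian, and for such vectors zero
cross-covariance is independence. -/
theorem indepFun_mulVec [IsProbabilityMeasure P] [Fintype o] [Fintype o'] (hU : HasGaussianLaw U P)
    (hW : ∀ c c', cov[fun ω => U ω c, fun ω => U ω c'; P] = W c c')
    {A : Matrix o γ ℝ} {B : Matrix o' γ ℝ} (hAB : A * W * Bᵀ = 0) :
    IndepFun (fun ω => A *ᵥ U ω) (fun ω => B *ᵥ U ω) P := by
  refine HasGaussianLaw.indepFun_of_covariance_eval (X := fun a ω => (A *ᵥ U ω) a)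
    (Y := fun b ω => (B *ᵥ U ω) b) ?_ fun a b => ?_
  · exact hU.map_fun ((Matrix.mulVecLin A).toContinuousLinearMap.prod
      (Matrix.mulVecLin B).toContinuousLinearMap)
  · rw [covariance_mulVec hU hW, hAB]; rfl

theorem map_toLp_mulVec [IsProbabilityMeasure P] [Fintype o] [DecidableEq o] (hU : HasGaussianLaw U P)
    (hW : ∀ c c', cov[fun ω => U ω c, fun ω => U ω c'; P] = W c c')
    {m : γ → ℝ} (hm : ∀ c, ∫ ω, U ω c ∂P = m c) (A : Matrix o γ ℝ)
    (hS : (A * W * Aᵀ).PosSemidef) :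
    P.map (fun ω => WithLp.toLp 2 (A *ᵥ U ω))
      = multivariateGaussian (WithLp.toLp 2 (A *ᵥ m)) (A * W * Aᵀ) := by
  have hA := hasGaussianLaw_mulVec hU A
  have hL : HasGaussianLaw (fun ω => WithLp.toLp 2 (A *ᵥ U ω)) P :=
    HasGaussianLaw.toLp_pi (X := fun a ω => (A *ᵥ U ω) a) 2 hA
  have := hL.isGaussian_map
  have hint : ∀ c, Integrable (fun ω => U ω c) P := fun c =>
    (HasGaussianLaw.eval (X := fun c ω => U ω c) hU c).integrable
  apply IsGaussian.ext
  · simp only [id_eq, integral_id_multivariateGaussian]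
    rw [integral_map hL.aemeasurable (by fun_prop)]
    ext a
    rw [eval_integral_piLp]
    · simp only [Matrix.mulVec, dotProduct]
      rw [integral_finsetSum _ fun c _ => (hint c).const_mul _]
      simp only [integral_const_mul, hm]
    · intro a
      exact (HasGaussianLaw.eval (X := fun a ω => (A *ᵥ U ω) a) hA a).integrable
  · rw [← ContinuousLinearMap.toBilinForm_inj]
    refine LinearMap.BilinForm.ext_basis (EuclideanSpace.basisFun o ℝ).toBasis fun i j ↦ ?_
    rw [ContinuousLinearMap.toBilinForm_apply, ContinuousLinearMap.toBilinForm_apply,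
      covarianceBilin_apply_eq_cov, covariance_map, covarianceBilin_multivariateGaussian hS]
    · have h1 (i : o) : (fun u => inner ℝ ((EuclideanSpace.basisFun o ℝ).toBasis i) u) ∘
          (fun ω => WithLp.toLp 2 (A *ᵥ U ω)) = fun ω => (A *ᵥ U ω) i := by
        ext; simp [PiLp.inner_apply]
      rw [h1, h1, covariance_mulVec hU hW]
      simp
    any_goals exact Measurable.aestronglyMeasurable (by fun_prop)
    · exact hL.aemeasurable
    · exact IsGaussian.memLp_two_id

/-- The posterior distribution in the linear Gaussian model `Y = H X + Z`, where the components of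
`X` and `Z` are independent with precisions `q` and `r`. -/
theorem condDistrib_linear_gaussian [IsProbabilityMeasure P] [Fintype o] {ι κ β : Type*}
    [Fintype ι] [Fintype κ] [DecidableEq ι] [DecidableEq κ] [DecidableEq o]
    [MeasurableSpace β] {X : Ω → ι → ℝ} {Z : Ω → κ → ℝ} {Y : Ω → β}
    {q m : ι → ℝ} {r : κ → ℝ} (hq : ∀ a, q a ≠ 0) (hr : ∀ k, r k ≠ 0)
    (hU : HasGaussianLaw (fun ω => Sum.elim (X ω) (Z ω)) P)
    (hW : ∀ c c', cov[fun ω => Sum.elim (X ω) (Z ω) c, fun ω => Sum.elim (X ω) (Z ω) c'; P]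
      = Matrix.diagonal (Sum.elim q r)⁻¹ c c')
    (hX : ∀ a, ∫ ω, X ω a ∂P = m a) (hZ : ∀ k, ∫ ω, Z ω k ∂P = 0)
    (H : Matrix κ ι ℝ) {Λ : Matrix ι ι ℝ}
    (hΛ : Λ = Matrix.diagonal q + Hᵀ * Matrix.diagonal r * H) (hpos : Λ.PosDef)
    {φ : (κ → ℝ) → β} {ψ : β → κ → ℝ} (hφ : Measurable φ) (hψ : Measurable ψ)
    (hψφ : ∀ u, ψ (φ u) = u) (hY : ∀ ω, Y ω = φ (H *ᵥ X ω + Z ω)) (C : Matrix o ι ℝ) :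
    ∀ᵐ v ∂(P.map Y), condDistrib (fun ω => WithLp.toLp 2 (C *ᵥ X ω)) Y P v
      = multivariateGaussian
        (WithLp.toLp 2 (C *ᵥ (Λ⁻¹ *ᵥ (q * m + Hᵀ *ᵥ (r * ψ v))))) (C * Λ⁻¹ * Cᵀ) := by
  set U : Ω → ι ⊕ κ → ℝ := fun ω => Sum.elim (X ω) (Z ω) with hUdef
  have hdet : IsUnit Λ.det := (Matrix.isUnit_iff_isUnit_det _).1 hpos.isUnit
  have hsymm : (Λ⁻¹)ᵀ = Λ⁻¹ := by
    have := hpos.inv.isHermitian.eq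
    rwa [Matrix.conjTranspose_eq_transpose_of_trivial] at this
  -- `K` is the regression matrix. As `1 - K H = Λ⁻¹ diag q`, the matrix `A` produces the residual
  -- `C (X - K Y)` from `U = (X, Z)`, while `B` produces the sample vector `H X + Z`.
  set K : Matrix ι κ ℝ := Λ⁻¹ * (Hᵀ * Matrix.diagonal r) with hK
  set A : Matrix o (ι ⊕ κ) ℝ := C * Matrix.fromCols (Λ⁻¹ * Matrix.diagonal q) (-K) with hA
  set B : Matrix κ (ι ⊕ κ) ℝ := Matrix.fromCols H 1 with hB
  have hWb : Matrix.diagonal (Sum.elim q r)⁻¹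
      = Matrix.fromBlocks (Matrix.diagonal q⁻¹) 0 0 (Matrix.diagonal r⁻¹) := by
    rw [Matrix.fromBlocks_diagonal]; congr 1; ext (a | a) <;> rfl
  have hqq : Matrix.diagonal q * Matrix.diagonal q⁻¹ = 1 := by
    rw [Matrix.diagonal_mul_diagonal, ← Matrix.diagonal_one]
    congr 1; ext a; simp [hq a]
  have hrr : Matrix.diagonal r * Matrix.diagonal r⁻¹ = 1 := by
    rw [Matrix.diagonal_mul_diagonal, ← Matrix.diagonal_one]
    congr 1; ext a; simp [hr a]
  have hAW : A * Matrix.diagonal (Sum.elim q r)⁻¹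
      = C * Matrix.fromCols Λ⁻¹ (-(Λ⁻¹ * Hᵀ)) := by
    rw [hA, hWb, Matrix.mul_assoc, Matrix.fromCols_mul_fromBlocks]
    simp [hK, Matrix.mul_assoc, hqq, hrr]
  -- The contributions of `X` and `Z` to the cross-covariance are `C Λ⁻¹ Hᵀ` and its negative.
  have hAB : A * Matrix.diagonal (Sum.elim q r)⁻¹ * Bᵀ = 0 := by
    rw [hAW, hB, Matrix.transpose_fromCols, Matrix.mul_assoc, Matrix.fromCols_mul_fromRows]
    simp
  have hone : Λ⁻¹ * Matrix.diagonal q + K * H = 1 := by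
    rw [hK, Matrix.mul_assoc Λ⁻¹, ← Matrix.mul_add, ← hΛ, Matrix.nonsing_inv_mul _ hdet]
  have hAA : A * Matrix.diagonal (Sum.elim q r)⁻¹ * Aᵀ = C * Λ⁻¹ * Cᵀ := by
    rw [hAW, hA, Matrix.transpose_mul, Matrix.transpose_fromCols, Matrix.mul_assoc,
      ← Matrix.mul_assoc _ _ Cᵀ, Matrix.fromCols_mul_fromRows, ← Matrix.mul_assoc]
    congr 2
    have h2 : (Λ⁻¹ * Matrix.diagonal q + K * H)ᵀ = 1 := by rw [hone, Matrix.transpose_one]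
    rw [Matrix.transpose_add, Matrix.transpose_mul K] at h2
    rw [Matrix.transpose_neg, Matrix.neg_mul, Matrix.mul_neg, neg_neg, Matrix.mul_assoc Λ⁻¹ Hᵀ,
      ← Matrix.mul_add, h2,
      Matrix.mul_one]
  have hS : (C * Λ⁻¹ * Cᵀ).PosSemidef := by
    have := hpos.inv.posSemidef.mul_mul_conjTranspose_same C
    rwa [Matrix.conjTranspose_eq_transpose_of_trivial] at this
  have hlaw := map_toLp_mulVec (m := Sum.elim m 0) hU hW
    (by rintro (a | k); exacts [hX a, hZ k]) A (by rwa [hAA])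
  rw [hAA] at hlaw
  have hBU : ∀ ω, B *ᵥ U ω = H *ᵥ X ω + Z ω := by
    intro ω; rw [hB, hUdef]; simp
  have hψY : ∀ ω, ψ (Y ω) = B *ᵥ U ω := by intro ω; rw [hY, hψφ, hBU]
  have hBm : AEMeasurable (fun ω => B *ᵥ U ω) P := (hasGaussianLaw_mulVec hU B).aemeasurable
  have hAm : AEMeasurable (fun ω => A *ᵥ U ω) P := (hasGaussianLaw_mulVec hU A).aemeasurable
  have hYeq : Y = fun ω => φ (B *ᵥ U ω) := by ext1 ω; rw [hY, hBU]
  have hYm : AEMeasurable Y P := by rw [hYeq]; exact hφ.comp_aemeasurable hBm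
  have hind : IndepFun (fun ω => WithLp.toLp 2 (A *ᵥ U ω)) Y P := by
    rw [hYeq]
    exact (indepFun_mulVec hU hW hAB).comp (φ := fun u => WithLp.toLp 2 u) (by fun_prop) hφ
  have hf : Measurable fun v : β => WithLp.toLp 2 (C *ᵥ (K *ᵥ ψ v)) := by
    have h1 : Measurable fun u : κ → ℝ => C *ᵥ (K *ᵥ u) :=
      ((Matrix.mulVecLin C).toContinuousLinearMap.continuous.comp
        (Matrix.mulVecLin K).toContinuousLinearMap.continuous).measurable
    have := h1.comp hψ
    fun_prop
  have hVm : AEMeasurable (fun ω => WithLp.toLp 2 (A *ᵥ U ω)) P :=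
    (WithLp.measurable_toLp 2 _).comp_aemeasurable hAm
  have hsplit : (fun ω => WithLp.toLp 2 (C *ᵥ X ω))
      = fun ω => WithLp.toLp 2 (C *ᵥ (K *ᵥ ψ (Y ω))) + WithLp.toLp 2 (A *ᵥ U ω) := by
    ext1 ω
    rw [← WithLp.toLp_add, hψY, hBU, hA, ← Matrix.mulVec_mulVec (U ω) C,
      Matrix.fromCols_mulVec_sumElim, ← Matrix.mulVec_add]
    congr 2
    calc X ω = (Λ⁻¹ * Matrix.diagonal q + K * H) *ᵥ X ω := by rw [hone, Matrix.one_mulVec]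
      _ = _ := by
        rw [Matrix.add_mulVec, Matrix.mulVec_add, Matrix.neg_mulVec, Matrix.mulVec_mulVec]
        abel
  rw [hsplit]
  filter_upwards [condDistrib_add_of_indepFun hVm hYm hind hf] with v hv
  rw [hv, hlaw, multivariateGaussian_map_const_add, ← WithLp.toLp_add]
  congr 2
  have e1 : Matrix.diagonal q *ᵥ m = q * m := by ext; simp [Matrix.mulVec_diagonal]
  have e2 : K *ᵥ ψ v = Λ⁻¹ *ᵥ (Hᵀ *ᵥ (r * ψ v)) := by
    rw [hK, ← Matrix.mulVec_mulVec, ← Matrix.mulVec_mulVec]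
    congr 2; ext; simp [Matrix.mulVec_diagonal]
  have e3 : A *ᵥ Sum.elim m 0 = C *ᵥ (Λ⁻¹ *ᵥ (q * m)) := by
    rw [hA, ← Matrix.mulVec_mulVec _ C, Matrix.fromCols_mulVec_sumElim, Matrix.mulVec_zero,
      add_zero, ← Matrix.mulVec_mulVec, e1]
  rw [e2, e3, ← Matrix.mulVec_add, ← Matrix.mulVec_add, add_comm]

end GaussianRegression

end OAC

/-! ### Complex Gaussian laws in real coordinates -/

namespace OAC

noncomputable section

/-- The real part (`e = 0`) or the imaginary part (`e = 1`) of a complex number. -/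
def realCoord (e : Fin 2) (z : ℂ) : ℝ := ![z.re, z.im] e

/-- `realCoord` as a continuous linear map. -/
def realCoordCLM (e : Fin 2) : ℂ →L[ℝ] ℝ := ![Complex.reCLM, Complex.imCLM] e

theorem realCoordCLM_apply (e : Fin 2) (z : ℂ) : realCoordCLM e z = realCoord e z := by
  fin_cases e <;> rfl

theorem measurable_realCoord (e : Fin 2) : Measurable (realCoord e) := by
  have : realCoord e = realCoordCLM e := by ext z; rw [realCoordCLM_apply]
  rw [this]; exact (realCoordCLM e).continuous.measurable

section ComplexGaussian

variable {Ω : Type*} [MeasurableSpace Ω] {P : Measure Ω}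

instance isGaussian_complexGaussian (μ : ℂ) (v : ℝ) : IsGaussian (complexGaussian μ v) := by
  have : (Complex.measurableEquivRealProd.symm : ℝ × ℝ → ℂ)
      = Complex.equivRealProdCLM.symm.toContinuousLinearMap := by
    ext p; rfl
  rw [complexGaussian, this]
  infer_instance

theorem measurePreserving_realCoord_complexGaussian (μ : ℂ) (v : ℝ) (e : Fin 2) :
    MeasurePreserving (realCoord e) (complexGaussian μ v)
      (gaussianReal (realCoord e μ) (v / 2).toNNReal) where
  measurable := measurable_realCoord e
  map_eq := by
    rw [complexGaussian, Measure.map_map (measurable_realCoord e) (by fun_prop)]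
    fin_cases e
    · exact Measure.fst_prod
    · exact Measure.snd_prod

theorem hasLaw_realCoord {s : Ω → ℂ} {μ : ℂ} {v : ℝ} (hs : HasLaw s (complexGaussian μ v) P)
    (e : Fin 2) :
    HasLaw (fun ω => realCoord e (s ω)) (gaussianReal (realCoord e μ) (v / 2).toNNReal) P :=
  (measurePreserving_realCoord_complexGaussian μ v e).hasLaw.comp hs

theorem integral_realCoord {s : Ω → ℂ} {μ : ℂ} {v : ℝ} (hs : HasLaw s (complexGaussian μ v) P)
    (e : Fin 2) : ∫ ω, realCoord e (s ω) ∂P = realCoord e μ := by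
  rw [(hasLaw_realCoord hs e).integral_eq, integral_id_gaussianReal]

theorem covariance_realCoord_complexGaussian (μ : ℂ) {v : ℝ} (hv : 0 < v) (e e' : Fin 2) :
    cov[realCoord e, realCoord e'; complexGaussian μ v] = if e = e' then v / 2 else 0 := by
  have hre : ∀ e, Var[realCoord e; complexGaussian μ v] = v / 2 := by
    intro e
    rw [(measurePreserving_realCoord_complexGaussian μ v e).hasLaw.variance_eq,
      variance_id_gaussianReal, Real.coe_toNNReal _ (by positivity)]
  have hri : cov[realCoord 0, realCoord 1; complexGaussian μ v] = 0 := by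
    rw [complexGaussian, covariance_map_equiv]
    refine IndepFun.covariance_eq_zero (X := Prod.fst) (Y := Prod.snd) ?_ ?_ ?_
    · exact indepFun_prod measurable_id measurable_id
    · exact (memLp_id_gaussianReal 2).comp_fst _
    · exact (memLp_id_gaussianReal 2).comp_snd _
  have hself : ∀ e, cov[realCoord e, realCoord e; complexGaussian μ v] = v / 2 := by
    intro e; rw [covariance_self (measurable_realCoord e).aemeasurable, hre]
  fin_cases e <;> fin_cases e'
  · simpa using hself 0
  · simpa using hri
  · rw [covariance_comm]; simpa using hri
  · simpa using hself 1

variable {α γ : Type*} {F : α → Ω → ℂ} {μ : α → ℂ} {v : α → ℝ}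

/-- Independent Gaussian variables are jointly Gaussian, and taking real and imaginary parts is real
linear. -/
theorem hasGaussianLaw_realCoords [Fintype α] [Fintype γ]
    (hF : ∀ a, HasLaw (F a) (complexGaussian (μ a) (v a)) P)
    (hind : iIndepFun F P) (node : γ → α) (part : γ → Fin 2) :
    HasGaussianLaw (fun ω c => realCoord (part c) (F (node c) ω)) P := by
  have h1 := iIndepFun.hasGaussianLaw (fun a => (hF a).hasGaussianLaw) hind
  have h2 := h1.map_fun (ContinuousLinearMap.pi fun c : γ =>
    (realCoordCLM (part c)).comp (ContinuousLinearMap.proj (R := ℝ) (φ := fun _ : α => ℂ) (node c)))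
  simpa [ContinuousLinearMap.coe_pi', realCoordCLM_apply] using! h2

theorem covariance_realCoords [DecidableEq α] (hv : ∀ a, 0 < v a)
    (hF : ∀ a, HasLaw (F a) (complexGaussian (μ a) (v a)) P)
    (hind : iIndepFun F P) (a a' : α) (e e' : Fin 2) :
    cov[fun ω => realCoord e (F a ω), fun ω => realCoord e' (F a' ω); P]
      = if a = a' ∧ e = e' then v a / 2 else 0 := by
  have := hind.isProbabilityMeasure
  by_cases ha : a = a'
  · subst ha
    have := (hF a).covariance_fun_comp (f := realCoord e) (g := realCoord e')
      (measurable_realCoord e).aemeasurable (measurable_realCoord e').aemeasurable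
    rw [this, covariance_realCoord_complexGaussian _ (hv a)]
    simp
  · rw [if_neg (by tauto)]
    have h2 : ∀ a e, MemLp (fun ω => realCoord e (F a ω)) 2 P := fun a e =>
      (hasLaw_realCoord (hF a) e).hasGaussianLaw.memLp_two
    exact ((hind.indepFun ha).comp (measurable_realCoord e)
      (measurable_realCoord e')).covariance_eq_zero (h2 a e) (h2 a' e')

end ComplexGaussian

end

end OAC

namespace OAC

noncomputable section

/-! ### The channel as a linear Gaussian model in real variables -/

/-- The symbol to which a real coordinate belongs. -/
def symbolOf {M : ℕ} (p : Fin M ⊕ Fin M) : Fin M := Sum.elim id id p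

/-- The indices of the real and imaginary parts of all symbols of all devices. -/
abbrev SymbolIndex (M L : ℕ) : Type := Fin L × (Fin M ⊕ Fin M)

/-- The indices of the real and imaginary parts of all samples. -/
abbrev SampleIndex (M L : ℕ) : Type := (Fin (L + 1) × Fin M) × Fin 2

/-- The matrix with the blocks `β₁` and `β₂`. -/
def gainMatrix {M : ℕ} (h : Fin M → ℂ) : Matrix (Fin M ⊕ Fin M) (Fin 2) ℝ :=
  Matrix.fromRows (beta₁ h) (beta₂ h)

/-- The time index of the symbol of device `m` that is present in the sample `y_k[i]`. -/
def slot {M : ℕ} (i : ℕ) (k m : Fin M) : ℕ := if m ≤ k then i + 1 else i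

/-- The matrix of the linear map from the symbols to the noiseless samples. -/
def channelMatrix {M : ℕ} (L : ℕ) (h : Fin M → ℂ) :
    Matrix (SampleIndex M L) (SymbolIndex M L) ℝ :=
  Matrix.of fun n a =>
    if slot (n.1.1 : ℕ) n.1.2 (symbolOf a.2) = (a.1 : ℕ) + 1 then gainMatrix h a.2 n.2 else 0

/-- The precisions of the real coordinates of the symbols. -/
def symbolPrec {M : ℕ} (L : ℕ) (D : Fin M → ℝ) (a : SymbolIndex M L) : ℝ := 2 / D (symbolOf a.2)

/-- The means of the real coordinates of the symbols. -/
def symbolMean {M : ℕ} (L : ℕ) (E : Fin M → ℂ) (a : SymbolIndex M L) : ℝ := realVec E a.2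

/-- The precisions of the real coordinates of the noise. -/
def samplePrec {M : ℕ} (L : ℕ) (N₀ : ℝ) (d : Fin M → ℝ) (n : SampleIndex M L) : ℝ :=
  2 * d n.1.2 / N₀

/-- The real coordinates of the samples. -/
def sampleCoords {M L : ℕ} (y : Fin (L + 1) → Fin M → ℂ) (n : SampleIndex M L) : ℝ :=
  realCoord n.2 (y n.1.1 n.1.2)

/-- The joint posterior precision matrix of all symbols. -/
def jointPrec {M : ℕ} (L : ℕ) (N₀ : ℝ) (d : Fin M → ℝ) (h : Fin M → ℂ) (D : Fin M → ℝ) :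
    Matrix (SymbolIndex M L) (SymbolIndex M L) ℝ :=
  Matrix.diagonal (symbolPrec L D)
    + (channelMatrix L h)ᵀ * Matrix.diagonal (samplePrec L N₀ d) * channelMatrix L h

/-- The joint posterior potential vector of all symbols. -/
def jointEta {M L : ℕ} (N₀ : ℝ) (d : Fin M → ℝ) (h : Fin M → ℂ) (E : Fin M → ℂ) (D : Fin M → ℝ)
    (y : Fin (L + 1) → Fin M → ℂ) : SymbolIndex M L → ℝ :=
  symbolPrec L D * symbolMean L E
    + (channelMatrix L h)ᵀ *ᵥ (samplePrec L N₀ d * sampleCoords y)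

/-- The joint posterior mean vector of all symbols. -/
def jointMean {M L : ℕ} (N₀ : ℝ) (d : Fin M → ℝ) (h : Fin M → ℂ) (E : Fin M → ℂ) (D : Fin M → ℝ)
    (y : Fin (L + 1) → Fin M → ℂ) : SymbolIndex M L → ℝ :=
  (jointPrec L N₀ d h D)⁻¹ *ᵥ jointEta N₀ d h E D y

theorem jointPrec_posDef {M : ℕ} (L : ℕ) {N₀ : ℝ} (hN₀ : 0 < N₀) {d : Fin M → ℝ}
    (hd : ∀ k, 0 < d k) (h : Fin M → ℂ) {D : Fin M → ℝ} (hD : ∀ m, 0 < D m) :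
    (jointPrec L N₀ d h D).PosDef := by
  refine Matrix.PosDef.add_posSemidef (Matrix.PosDef.diagonal fun a => ?_) ?_
  · exact div_pos two_pos (hD _)
  · have h1 : (Matrix.diagonal (samplePrec L N₀ d)).PosSemidef :=
      Matrix.PosSemidef.diagonal fun n => (div_pos (mul_pos two_pos (hd _)) hN₀).le
    have := h1.conjTranspose_mul_mul_same (channelMatrix L h)
    rwa [Matrix.conjTranspose_eq_transpose_of_trivial] at this

theorem realCoord_sum_mul {M : ℕ} (h w : Fin M → ℂ) (e : Fin 2) :
    realCoord e (∑ m, h m * w m) = ∑ p, gainMatrix h p e * realVec w p := by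
  rw [← realCoordCLM_apply, map_sum, Fintype.sum_sum_type, ← Finset.sum_add_distrib]
  refine Finset.sum_congr rfl fun m _ => ?_
  rw [realCoordCLM_apply]
  fin_cases e <;> simp [realCoord, gainMatrix, realVec, beta₁, beta₂] <;> ring

/-- At the times `0` and `L + 1` no index matches and the sum is empty, which reproduces the
convention `s_m[0] = s_m[L+1] = 0`. -/
theorem sum_symbols_eq_symbolAt {M L : ℕ} (s : Fin L → Fin M → ℂ) (t : ℕ) (p : Fin M ⊕ Fin M) :
    ∑ j : Fin L, (if t = (j : ℕ) + 1 then realVec (s j) p else 0)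
      = Sum.elim (fun m => (symbolAt s t m).re) (fun m => (symbolAt s t m).im) p := by
  by_cases ht : 1 ≤ t ∧ t ≤ L
  · rw [Finset.sum_eq_single (⟨t - 1, by omega⟩ : Fin L)]
    · rw [if_pos (by simp; omega)]
      rcases p with m | m <;> simp [symbolAt, ht, realVec]
    · intro j _ hj
      rw [if_neg]
      intro h
      exact hj (Fin.ext (by simp [h]))
    · simp
  · rw [Finset.sum_eq_zero]
    · rcases p with m | m <;> simp [symbolAt, ht]
    · intro j _
      rw [if_neg]
      intro h
      exact ht (by omega)

theorem channelMatrix_mulVec {M L : ℕ} (h : Fin M → ℂ) (s : Fin L → Fin M → ℂ)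
    (n : SampleIndex M L) :
    (channelMatrix L h *ᵥ fun a => realVec (s a.1) a.2) n
      = realCoord n.2 (∑ m, h m * neighbour s n.1.1 n.1.2 m) := by
  rw [realCoord_sum_mul]
  simp only [Matrix.mulVec, dotProduct, channelMatrix, Matrix.of_apply]
  rw [Fintype.sum_prod_type_right]
  refine Finset.sum_congr rfl fun p _ => ?_
  have := sum_symbols_eq_symbolAt s (slot (n.1.1 : ℕ) n.1.2 (symbolOf p)) p
  calc _ = gainMatrix h p n.2 * ∑ j : Fin L,
        (if slot (n.1.1 : ℕ) n.1.2 (symbolOf p) = (j : ℕ) + 1 then realVec (s j) p else 0) := by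
        rw [Finset.mul_sum]
        exact Finset.sum_congr rfl fun j _ => by split_ifs <;> simp
    _ = _ := by
        rw [this]
        rcases p with m | m <;> rfl

/-- The matrix that extracts the symbols with the time index `i`. -/
def timeSelector (M : ℕ) {L : ℕ} (i : Fin L) : Matrix (Fin M ⊕ Fin M) (SymbolIndex M L) ℝ :=
  (1 : Matrix (SymbolIndex M L) (SymbolIndex M L) ℝ).submatrix (Prod.mk i) id

theorem timeSelector_mulVec {M L : ℕ} (i : Fin L) (u : SymbolIndex M L → ℝ) :
    timeSelector M i *ᵥ u = fun p => u (i, p) := by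
  ext p
  simp [timeSelector, Matrix.mulVec, dotProduct, Matrix.one_apply]

/-- The matrix that sums the real parts and the imaginary parts. -/
def sumMatrix (M : ℕ) : Matrix (Unit ⊕ Unit) (Fin M ⊕ Fin M) ℝ :=
  Matrix.fromBlocks (Matrix.of fun _ _ => 1) 0 0 (Matrix.of fun _ _ => 1)

theorem sumMatrix_mulVec {M : ℕ} (μ : Fin M ⊕ Fin M → ℝ) : sumMatrix M *ᵥ μ = sumMean μ := by
  ext (u | u) <;> simp [sumMatrix, sumMean, Matrix.mulVec, dotProduct]

theorem sumMatrix_conj {M : ℕ} (S : Matrix (Fin M ⊕ Fin M) (Fin M ⊕ Fin M) ℝ) :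
    sumMatrix M * S * (sumMatrix M)ᵀ = sumCov S := by
  ext (u | u) (v | v) <;>
    simp [sumMatrix, sumCov, Matrix.mul_apply, Matrix.mulVec, dotProduct, Matrix.toBlocks₁₁,
      Matrix.toBlocks₁₂, Matrix.toBlocks₂₁, Matrix.toBlocks₂₂] <;>
    exact Finset.sum_comm

/-- The summation matrix has full row rank because there is at least one device, so conjugation by
it preserves definiteness. -/
theorem sumCov_posDef {M : ℕ} [NeZero M] {S : Matrix (Fin M ⊕ Fin M) (Fin M ⊕ Fin M) ℝ}
    (hS : S.PosDef) : (sumCov S).PosDef := by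
  rw [← sumMatrix_conj, ← Matrix.conjTranspose_eq_transpose_of_trivial]
  refine hS.mul_mul_conjTranspose_same ?_
  intro u v huv
  have h0 : ∀ w : Unit ⊕ Unit → ℝ, w ᵥ* sumMatrix M
      = Sum.elim (fun _ => w (Sum.inl ())) (fun _ => w (Sum.inr ())) := by
    intro w
    ext (m | m) <;> simp [sumMatrix, Matrix.vecMul, dotProduct]
  simp only [h0] at huv
  ext (a | a)
  · exact congrFun huv (Sum.inl 0)
  · exact congrFun huv (Sum.inr 0)

theorem realVec_sum {M : ℕ} (w : Fin M → ℂ) :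
    (realVec fun _ : Unit => ∑ m, w m) = WithLp.toLp 2 (sumMatrix M *ᵥ (realVec w).ofLp) := by
  rw [sumMatrix_mulVec]
  ext (u | u) <;> simp [realVec, sumMean, dotProduct]

/-- The posterior distribution of a linear image of all symbols given all samples. -/
theorem condDistrib_symbols {M L : ℕ}
    {N₀ : ℝ} (hN₀ : 0 < N₀) {d : Fin M → ℝ} (hd : ∀ k, 0 < d k) (h : Fin M → ℂ)
    {E : Fin M → ℂ} {D : Fin M → ℝ} (hD : ∀ m, 0 < D m)
    {Ω : Type*} [MeasurableSpace Ω] {P : Measure Ω} [IsProbabilityMeasure P]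
    {s : Fin L → Fin M → Ω → ℂ} {z y : Fin (L + 1) → Fin M → Ω → ℂ}
    (hs : ∀ i m, HasLaw (s i m) (complexGaussian (E m) (D m)) P)
    (hz : ∀ i k, HasLaw (z i k) (complexGaussian 0 (N₀ / d k)) P)
    (hindep : iIndepFun (Sum.elim (fun p : Fin L × Fin M => s p.1 p.2)
      (fun p : Fin (L + 1) × Fin M => z p.1 p.2)) P)
    (hy : ∀ i k ω, y i k ω = ∑ m, h m * neighbour (fun j l => s j l ω) i k m + z i k ω)
    {o : Type*} [Fintype o] [DecidableEq o] (C : Matrix o (SymbolIndex M L) ℝ) :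
    ∀ᵐ v ∂(P.map fun ω j k => y j k ω),
      condDistrib (fun ω => WithLp.toLp 2 (C *ᵥ fun a => realVec (fun m => s a.1 m ω) a.2))
          (fun ω j k => y j k ω) P v
        = multivariateGaussian (WithLp.toLp 2 (C *ᵥ jointMean N₀ d h E D v))
            (C * (jointPrec L N₀ d h D)⁻¹ * Cᵀ) := by
  set F : Fin L × Fin M ⊕ Fin (L + 1) × Fin M → Ω → ℂ :=
    Sum.elim (fun p => s p.1 p.2) (fun p => z p.1 p.2) with hF
  set μF : Fin L × Fin M ⊕ Fin (L + 1) × Fin M → ℂ := Sum.elim (fun p => E p.2) (fun _ => 0)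
  set vF : Fin L × Fin M ⊕ Fin (L + 1) × Fin M → ℝ :=
    Sum.elim (fun p => D p.2) (fun p => N₀ / d p.2)
  have hlaw : ∀ a, HasLaw (F a) (complexGaussian (μF a) (vF a)) P := by
    rintro (a | a)
    exacts [hs a.1 a.2, hz a.1 a.2]
  have hv : ∀ a, 0 < vF a := by
    rintro (a | a)
    exacts [hD a.2, div_pos hN₀ (hd a.2)]
  let node : SymbolIndex M L ⊕ SampleIndex M L → Fin L × Fin M ⊕ Fin (L + 1) × Fin M :=
    Sum.map (fun a => (a.1, symbolOf a.2)) Prod.fst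
  let part : SymbolIndex M L ⊕ SampleIndex M L → Fin 2 :=
    Sum.elim (fun a => Sum.elim (fun _ => 0) (fun _ => 1) a.2) Prod.snd
  -- A real coordinate is determined by its complex variable and its part, so the covariance matrix
  -- is diagonal.
  have hnode : ∀ c c', (node c = node c' ∧ part c = part c') ↔ c = c' := by
    rintro (⟨t, p | p⟩ | ⟨n, e⟩) (⟨t', p' | p'⟩ | ⟨n', e'⟩) <;> simp [node, part, symbolOf]
  have hUF : ∀ ω c, Sum.elim (fun a : SymbolIndex M L => realVec (fun m => s a.1 m ω) a.2)
      (fun n : SampleIndex M L => realCoord n.2 (z n.1.1 n.1.2 ω)) c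
      = realCoord (part c) (F (node c) ω) := by
    rintro ω (⟨t, p | p⟩ | n) <;> rfl
  have hUF' : (fun ω => Sum.elim (fun a : SymbolIndex M L => realVec (fun m => s a.1 m ω) a.2)
      (fun n : SampleIndex M L => realCoord n.2 (z n.1.1 n.1.2 ω)))
      = fun ω c => realCoord (part c) (F (node c) ω) := by
    ext ω c; exact hUF ω c
  refine condDistrib_linear_gaussian (q := symbolPrec L D) (m := symbolMean L E)
    (r := samplePrec L N₀ d)
    (Z := fun ω n => realCoord n.2 (z n.1.1 n.1.2 ω))
    (φ := fun u i k => ⟨u ((i, k), 0), u ((i, k), 1)⟩) (ψ := sampleCoords)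
    (fun a => (div_pos two_pos (hD _)).ne')
    (fun n => (div_pos (mul_pos two_pos (hd _)) hN₀).ne') ?_ ?_ ?_ ?_ (channelMatrix L h) rfl
    (jointPrec_posDef L hN₀ hd h hD) ?_ ?_ ?_ ?_ C
  · rw [hUF']
    exact hasGaussianLaw_realCoords hlaw hindep node part
  · intro c c'
    simp only [hUF]
    rw [covariance_realCoords hv hlaw hindep, Matrix.diagonal_apply]
    simp only [hnode]
    refine if_congr Iff.rfl ?_ rfl
    rcases c with a | n
    · simp [vF, node, symbolPrec]
    · simp [vF, node, samplePrec]; field_simp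
  · rintro ⟨t, p⟩
    refine (integral_congr_ae (ae_of_all P fun ω => hUF ω (Sum.inl (t, p)))).trans ?_
    rw [integral_realCoord (hlaw _)]
    rcases p with p | p <;> rfl
  · intro n
    refine (integral_congr_ae (ae_of_all P fun ω => hUF ω (Sum.inr n))).trans ?_
    rw [integral_realCoord (hlaw _)]
    simp only [μF, node, Sum.map_inr, Sum.elim_inr]
    rw [← realCoordCLM_apply, map_zero]
  · refine measurable_pi_lambda _ fun i => measurable_pi_lambda _ fun k => ?_
    have h1 : Measurable fun u : SampleIndex M L → ℝ => (u ((i, k), 0), u ((i, k), 1)) := by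
      fun_prop
    exact Complex.measurableEquivRealProd.symm.measurable.comp h1
  · refine measurable_pi_lambda _ fun n => (measurable_realCoord n.2).comp ?_
    fun_prop
  · intro u
    ext ⟨⟨i, k⟩, e⟩
    fin_cases e <;> rfl
  · intro ω
    ext i k
    have hX : ∀ e, (channelMatrix L h *ᵥ fun a => realVec (fun m => s a.1 m ω) a.2) ((i, k), e)
        = _ := fun e => channelMatrix_mulVec h (fun j l => s j l ω) ((i, k), e)
    have h2 : ∀ e, realCoord e (y i k ω) = realCoord e
        (∑ m, h m * neighbour (fun j l => s j l ω) i k m) + realCoord e (z i k ω) := by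
      intro e
      rw [hy]
      simp only [← realCoordCLM_apply, map_add]
    apply Complex.ext
    · simp only [Pi.add_apply, hX]
      exact h2 0
    · simp only [Pi.add_apply, hX]
      exact h2 1

end

end OAC

namespace OAC

noncomputable section

/-! ### Pseudoinverses of matrices that are positive definite on a set of coordinates -/

theorem pinv_eq {n : Type*} [Fintype n] {A B : Matrix n n ℝ} (h : IsMoorePenrose A B) :
    pinv A = B := by
  have hex : ∃ B, IsMoorePenrose A B := ⟨B, h⟩
  rw [pinv, dif_pos hex]
  exact hex.choose_spec.unique h

theorem pinv_eq_of_mul_eq_one {n : Type*} [Fintype n] [DecidableEq n] {A B : Matrix n n ℝ}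
    (h : A * B = 1) : pinv A = B := by
  have h' : B * A = 1 := mul_eq_one_comm.1 h
  exact pinv_eq ⟨by rw [h, one_mul], by rw [h', one_mul], by rw [h, Matrix.transpose_one],
    by rw [h', Matrix.transpose_one]⟩

/-- The symmetric matrix `A` vanishes outside the coordinates in `T` and is positive definite
on them. -/
structure PosDefOn {n : Type*} [Fintype n] (T : Set n) (A : Matrix n n ℝ) : Prop where
  symm : Aᵀ = A
  eq_zero : ∀ p q, p ∉ T → A p q = 0
  pos : ∀ x : n → ℝ, (∃ p ∈ T, x p ≠ 0) → 0 < x ⬝ᵥ A *ᵥ x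

open Classical in
/-- The orthogonal projection onto the coordinates in `T`. -/
def coordProj {n : Type*} (T : Set n) : Matrix n n ℝ :=
  Matrix.diagonal fun p => if p ∈ T then 1 else 0

section PosDefOn

variable {n : Type*} [Fintype n] {T : Set n} {A : Matrix n n ℝ}

theorem coordProj_mulVec_of_mem (T : Set n) (x : n → ℝ) {p : n} (hp : p ∈ T) :
    (coordProj T *ᵥ x) p = x p := by
  classical
  rw [coordProj]
  simp [Matrix.mulVec, dotProduct, Matrix.diagonal_apply, hp]

theorem coordProj_mulVec_of_support {x : n → ℝ} (hx : ∀ p, p ∉ T → x p = 0) :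
    coordProj T *ᵥ x = x := by
  classical
  ext p
  by_cases hp : p ∈ T
  · exact coordProj_mulVec_of_mem T x hp
  · rw [coordProj]
    simp [Matrix.mulVec, dotProduct, Matrix.diagonal_apply, hp, hx p hp]

theorem PosDefOn.eq_zero_right (hA : PosDefOn T A) (p q : n) (hq : q ∉ T) : A p q = 0 := by
  rw [← hA.symm, Matrix.transpose_apply, hA.eq_zero q p hq]

theorem PosDefOn.mulVec_eq_zero (hA : PosDefOn T A) {x : n → ℝ} (hx : ∀ p ∈ T, x p = 0) :
    A *ᵥ x = 0 := by
  ext p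
  refine Finset.sum_eq_zero fun q _ => ?_
  by_cases hq : q ∈ T
  · rw [hx q hq, mul_zero]
  · exact mul_eq_zero_of_left (hA.eq_zero_right p q hq) _

theorem PosDefOn.mulVec_apply_eq_zero (hA : PosDefOn T A) (x : n → ℝ) {p : n} (hp : p ∉ T) :
    (A *ᵥ x) p = 0 :=
  Finset.sum_eq_zero fun q _ => mul_eq_zero_of_left (hA.eq_zero p q hp) _

theorem PosDefOn.nonneg (hA : PosDefOn T A) (x : n → ℝ) : 0 ≤ x ⬝ᵥ A *ᵥ x := by
  by_cases h : ∃ p ∈ T, x p ≠ 0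
  · exact (hA.pos x h).le
  · push Not at h
    rw [hA.mulVec_eq_zero h, dotProduct_zero]

theorem PosDefOn.zero : PosDefOn (∅ : Set n) (0 : Matrix n n ℝ) :=
  ⟨Matrix.transpose_zero, fun _ _ _ => rfl, by simp⟩

theorem PosDefOn.posDef (hA : PosDefOn Set.univ A) : A.PosDef := by
  refine Matrix.PosDef.of_dotProduct_mulVec_pos ?_ fun x hx => ?_
  · rw [Matrix.IsHermitian, Matrix.conjTranspose_eq_transpose_of_trivial, hA.symm]
  · obtain ⟨p, hp⟩ := Function.ne_iff.1 hx
    simpa using hA.pos x ⟨p, trivial, hp⟩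

/-- If `x` is nonzero somewhere on `T`, the old form is already positive; otherwise the new form
only has to be positive on vectors that vanish on `T`. This is why `hpos` is restricted to those. -/
theorem PosDefOn.add (hA : PosDefOn T A) {U : Set n} {B : Matrix n n ℝ} (hsymm : Bᵀ = B)
    (hzero : ∀ p q, p ∉ U → B p q = 0) (hnonneg : ∀ x : n → ℝ, 0 ≤ x ⬝ᵥ B *ᵥ x)
    (hpos : ∀ x : n → ℝ, (∀ p ∈ T, x p = 0) → (∃ p ∈ U, x p ≠ 0) → 0 < x ⬝ᵥ B *ᵥ x) :
    PosDefOn (T ∪ U) (B + A) := by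
  refine ⟨by rw [Matrix.transpose_add, hA.symm, hsymm], fun p q hp => ?_, fun x hx => ?_⟩
  · rw [Set.mem_union, not_or] at hp
    rw [Matrix.add_apply, hA.eq_zero p q hp.1, hzero p q hp.2, add_zero]
  · rw [Matrix.add_mulVec, dotProduct_add]
    by_cases h : ∃ p ∈ T, x p ≠ 0
    · exact add_pos_of_nonneg_of_pos (hnonneg x) (hA.pos x h)
    · push Not at h
      obtain ⟨p, hp | hp, hxp⟩ := hx
      · exact absurd (h p hp) hxp
      · exact add_pos_of_pos_of_nonneg (hpos x h ⟨p, hp, hxp⟩) (hA.nonneg x)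

/-- With `D` the projection onto the complement of `T`, the matrix `A + D` is positive definite and
block diagonal, so `A† = (A + D)⁻¹ - D` inverts `A` on `T` and vanishes elsewhere. -/
theorem PosDefOn.pinv_spec (hA : PosDefOn T A) :
    PosDefOn T (pinv A) ∧ A * pinv A = coordProj T ∧ pinv A * A = coordProj T := by
  classical
  set D : Matrix n n ℝ := coordProj Tᶜ with hD
  have hproj : coordProj T = 1 - D := by
    rw [hD, coordProj, coordProj, ← Matrix.diagonal_one, Matrix.diagonal_sub]
    congr 1; ext p; by_cases hp : p ∈ T <;> simp [hp]
  have hDsymm : Dᵀ = D := by rw [hD, coordProj, Matrix.diagonal_transpose]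
  have hDD : D * D = D := by
    rw [hD, coordProj, Matrix.diagonal_mul_diagonal]
    congr 1; ext p; by_cases hp : p ∈ T <;> simp [hp]
  have hDA : D * A = 0 := by
    ext p q
    rw [hD, coordProj, Matrix.diagonal_mul]
    by_cases hp : p ∈ T
    · simp [hp]
    · simp [hA.eq_zero p q hp]
  have hAD : A * D = 0 := by
    rw [← Matrix.transpose_inj, Matrix.transpose_mul, hDsymm, hA.symm, hDA, Matrix.transpose_zero]
  have hpd : (A + D).PosDef := by
    have := hA.add (B := D) (U := Tᶜ) hDsymm ?_ ?_ ?_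
    · rw [Set.union_compl_self, add_comm] at this
      exact this.posDef
    · intro p q hp
      rw [hD, coordProj, Matrix.diagonal_apply]
      simp [hp]
    · intro x
      rw [hD, coordProj, dotProduct]
      refine Finset.sum_nonneg fun p _ => ?_
      rw [Matrix.mulVec_diagonal]
      split_ifs
      · rw [one_mul]; exact mul_self_nonneg _
      · simp
    · rintro x - ⟨p, hp, hxp⟩
      rw [hD, coordProj, dotProduct]
      refine Finset.sum_pos' (fun p _ => ?_) ⟨p, Finset.mem_univ p, ?_⟩
      · rw [Matrix.mulVec_diagonal]
        split_ifs
        · rw [one_mul]; exact mul_self_nonneg _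
        · simp
      · rw [Matrix.mulVec_diagonal, if_pos hp, one_mul]
        exact mul_self_pos.2 hxp
  have hdet : IsUnit (A + D).det := (Matrix.isUnit_iff_isUnit_det _).1 hpd.isUnit
  set N := (A + D)⁻¹ with hN
  have hDN : D * N = D := by
    calc D * N = D * (A + D) * N := by rw [Matrix.mul_add, hDA, hDD, zero_add]
      _ = D := by rw [Matrix.mul_assoc, Matrix.mul_nonsing_inv _ hdet, Matrix.mul_one]
  have hND : N * D = D := by
    calc N * D = N * ((A + D) * D) := by rw [Matrix.add_mul, hAD, hDD, zero_add]
      _ = D := by rw [← Matrix.mul_assoc, Matrix.nonsing_inv_mul _ hdet, Matrix.one_mul]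
  have hAB : A * (N - D) = 1 - D := by
    calc A * (N - D) = (A + D) * N - D * N - A * D := by
          rw [Matrix.mul_sub, Matrix.add_mul]; abel
      _ = 1 - D := by rw [Matrix.mul_nonsing_inv _ hdet, hDN, hAD, sub_zero]
  have hBA : (N - D) * A = 1 - D := by
    calc (N - D) * A = N * (A + D) - N * D - D * A := by
          rw [Matrix.sub_mul, Matrix.mul_add]; abel
      _ = 1 - D := by rw [Matrix.nonsing_inv_mul _ hdet, hND, hDA, sub_zero]
  have hDB : D * (N - D) = 0 := by rw [Matrix.mul_sub, hDN, hDD, sub_self]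
  have hBAB : (N - D) * A * (N - D) = N - D := by
    rw [hBA, Matrix.sub_mul, Matrix.one_mul, hDB, sub_zero]
  have hpinv : pinv A = N - D := by
    refine pinv_eq ⟨?_, hBAB, ?_, ?_⟩
    · rw [hAB, Matrix.sub_mul, Matrix.one_mul, hDA, sub_zero]
    · rw [hAB, Matrix.transpose_sub, Matrix.transpose_one, hDsymm]
    · rw [hBA, Matrix.transpose_sub, Matrix.transpose_one, hDsymm]
  have hBsymm : (N - D)ᵀ = N - D := by
    have := hpd.inv.isHermitian.eq
    rw [Matrix.conjTranspose_eq_transpose_of_trivial] at this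
    rw [Matrix.transpose_sub, hDsymm, hN, this]
  rw [hpinv, hproj]
  refine ⟨⟨hBsymm, fun p q hp => ?_, fun x hx => ?_⟩, hAB, hBA⟩
  · have := congrFun (congrFun hDB p) q
    have h1 : (D * (N - D)) p q = (N - D) p q := by
      rw [hD, coordProj, Matrix.diagonal_mul, if_pos (show p ∈ Tᶜ from hp), one_mul]
    rw [h1] at this
    exact this
  -- With `B = N - D`, the identity `B = B A B` rewrites the form of `B` at `x` as the form of `A`
  -- at `B x`. If `B x` vanished on `T`, then `A B x`, the projection of `x`, would be zero.
  · have h1 : x ⬝ᵥ (N - D) *ᵥ x = ((N - D) *ᵥ x) ⬝ᵥ A *ᵥ ((N - D) *ᵥ x) := by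
      conv_lhs => rw [← hBAB]
      rw [← Matrix.mulVec_mulVec, ← Matrix.mulVec_mulVec, Matrix.dotProduct_mulVec,
        ← Matrix.mulVec_transpose, hBsymm]
    rw [h1]
    apply hA.pos
    by_contra h
    push Not at h
    have h2 := hA.mulVec_eq_zero h
    rw [Matrix.mulVec_mulVec, hAB, ← hproj] at h2
    obtain ⟨p, hp, hxp⟩ := hx
    apply hxp
    rw [← coordProj_mulVec_of_mem T x hp, h2]
    rfl

-- Deleting the coordinates in `J` evaluates the same form at `x` with its entries in `J` set to
-- zero.
open Classical in
theorem PosDefOn.delete (hA : PosDefOn T A) (J : Set n) :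
    PosDefOn (T \ J) (Matrix.of fun p q => if p ∈ J ∨ q ∈ J then 0 else A p q) := by
  refine ⟨?_, fun p q hp => ?_, fun x hx => ?_⟩
  · ext p q
    simp only [Matrix.transpose_apply, Matrix.of_apply]
    exact if_congr or_comm rfl (congrFun (congrFun hA.symm p) q)
  · rw [Matrix.of_apply]
    split_ifs with h
    · rfl
    · exact hA.eq_zero p q fun hT => hp ⟨hT, fun hJ => h (Or.inl hJ)⟩
  · have h1 : x ⬝ᵥ (Matrix.of fun p q => if p ∈ J ∨ q ∈ J then 0 else A p q) *ᵥ x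
        = (fun p => if p ∈ J then 0 else x p) ⬝ᵥ A *ᵥ (fun p => if p ∈ J then 0 else x p) := by
      simp only [dotProduct, Matrix.mulVec, Matrix.of_apply, Finset.mul_sum]
      refine Finset.sum_congr rfl fun p _ => Finset.sum_congr rfl fun q _ => ?_
      by_cases hp : p ∈ J <;> by_cases hq : q ∈ J <;> simp [hp, hq]
    rw [h1]
    obtain ⟨p, hp, hxp⟩ := hx
    exact hA.pos _ ⟨p, hp.1, by simpa [hp.2] using hxp⟩

end PosDefOn

/-! ### Messages as quadratic forms -/

/-- The gradient of the quadratic form `½ wᵀ Λ w - wᵀ η`. -/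
def Message.grad {M : ℕ} (a : Message M) (w : Fin M ⊕ Fin M → ℝ) : Fin M ⊕ Fin M → ℝ :=
  a.prec *ᵥ w - a.eta

theorem Message.grad_prod {M : ℕ} (a b : Message M) (w : Fin M ⊕ Fin M → ℝ) :
    (a.prod b).grad w = a.grad w + b.grad w := by
  simp only [Message.grad, Message.prod, Matrix.add_mulVec]
  abel

theorem Message.grad_flat {M : ℕ} (w : Fin M ⊕ Fin M → ℝ) : (Message.flat M).grad w = 0 := by
  simp [Message.grad, Message.flat]

/-- The message `a` is a nondegenerate Gaussian in the coordinates `T` and does not depend on the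
other coordinates. -/
structure Message.GaussianOn {M : ℕ} (T : Set (Fin M ⊕ Fin M)) (a : Message M) : Prop where
  prec : PosDefOn T a.prec
  eta : ∀ p, p ∉ T → a.eta p = 0

theorem Message.GaussianOn.flat {M : ℕ} : Message.GaussianOn ∅ (Message.flat M) :=
  ⟨PosDefOn.zero, fun _ _ => rfl⟩

/-- Replacing a symbol in a message amounts to minimizing the quadratic form over the old symbol. -/
theorem Message.GaussianOn.replaceSymbol {M : ℕ} {T : Set (Fin M ⊕ Fin M)} {a : Message M}
    (ha : a.GaussianOn T) (j : Fin M) :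
    (a.replaceSymbol j).GaussianOn (T \ {p | ofSymbol j p}) ∧
    ∀ w', ∃ w, (∀ p, ¬ofSymbol j p → w p = w' p) ∧
      (∀ p, ¬ofSymbol j p → a.grad w p = (a.replaceSymbol j).grad w' p) ∧
      ∀ p, ofSymbol j p → a.grad w p = 0 ∧ (a.replaceSymbol j).grad w' p = 0 := by
  classical
  set J : Set (Fin M ⊕ Fin M) := {p | ofSymbol j p} with hJ
  have hmem : ∀ p, p ∈ J ↔ ofSymbol j p := fun _ => Iff.rfl
  obtain ⟨hB, hAB, -⟩ := ha.prec.pinv_spec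
  set B := pinv a.prec with hBdef
  set S : Matrix (Fin M ⊕ Fin M) (Fin M ⊕ Fin M) ℝ :=
    Matrix.of fun p q => if p ∈ J ∨ q ∈ J then 0 else B p q with hS
  have hSpd : PosDefOn (T \ J) S := by
    have := hB.delete J
    convert this
  obtain ⟨hC, hSC, hCS⟩ := hSpd.pinv_spec
  set μ' : Fin M ⊕ Fin M → ℝ := fun p => if p ∈ J then 0 else a.mean p with hμ'
  have hrep : a.replaceSymbol j = ⟨pinv S *ᵥ μ', pinv S⟩ := by
    rw [Message.replaceSymbol, Message.ofMoments]
    congr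
  have hmean : a.mean = B *ᵥ a.eta := rfl
  rw [hrep]
  refine ⟨⟨hC, fun p hp => hC.mulVec_apply_eq_zero _ hp⟩, fun w' => ?_⟩
  -- `g` is the gradient of the new message at `w'`, supported in `T \ J`. The point `w` is chosen
  -- so that the old gradient there is also `g`: solve `Λ w = η + g` on `T`, and copy `w'` off `T`,
  -- where the old form is constant.
  set g : Fin M ⊕ Fin M → ℝ := pinv S *ᵥ (w' - μ') with hg
  have hgrad : Message.grad ⟨pinv S *ᵥ μ', pinv S⟩ w' = g := by
    rw [Message.grad, hg, Matrix.mulVec_sub]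
  have hgz : ∀ p, p ∉ T \ J → g p = 0 := fun p hp => hC.mulVec_apply_eq_zero _ hp
  have hgT : ∀ p, p ∉ T → g p = 0 := fun p hp => hgz p fun h => hp h.1
  have hgJ : ∀ p, p ∈ J → g p = 0 := fun p hp => hgz p fun h => h.2 hp
  have hw : a.grad (B *ᵥ (a.eta + g) + fun p => if p ∈ T then 0 else w' p) = g := by
    have h0 : a.prec *ᵥ (fun p => if p ∈ T then 0 else w' p) = 0 :=
      ha.prec.mulVec_eq_zero fun p hp => if_pos hp
    rw [Message.grad, Matrix.mulVec_add, h0, add_zero, Matrix.mulVec_mulVec, hAB,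
      coordProj_mulVec_of_support, add_sub_cancel_left]
    intro p hp
    rw [Pi.add_apply, ha.eta p hp, hgT p hp, add_zero]
  refine ⟨B *ᵥ (a.eta + g) + fun p => if p ∈ T then 0 else w' p, fun p hp => ?_, fun p _ => ?_,
    fun p hp => ⟨?_, ?_⟩⟩
  · by_cases hT : p ∈ T
    -- Since `g` vanishes on `J`, deleting the rows and columns of `J` does not change `B g` off
    -- `J`. There `B g = S g = w' - μ'` on `T`, so `w` agrees with `w'`.
    · have hSg : (S *ᵥ g) p = (B *ᵥ g) p := by
        simp only [Matrix.mulVec, dotProduct]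
        refine Finset.sum_congr rfl fun q _ => ?_
        by_cases hq : q ∈ J
        · rw [hgJ q hq, mul_zero, mul_zero]
        · have : ¬(p ∈ J ∨ q ∈ J) := by rw [not_or]; exact ⟨hp, hq⟩
          rw [hS, Matrix.of_apply, if_neg this]
      have hSg2 : (S *ᵥ g) p = w' p - μ' p := by
        rw [hg, Matrix.mulVec_mulVec, hSC, coordProj_mulVec_of_mem (T \ J) _ ⟨hT, hp⟩, Pi.sub_apply]
      have hμp : μ' p = (B *ᵥ a.eta) p := by
        rw [hμ', ← hmean]; exact if_neg hp
      simp only [Pi.add_apply, if_pos hT, Matrix.mulVec_add]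
      rw [← hSg, hSg2, hμp]
      ring
    · rw [Pi.add_apply, if_neg hT, hB.mulVec_apply_eq_zero _ hT, zero_add]
  · rw [hw, hgrad]
  · rw [hw]; exact hgJ p hp
  · rw [hgrad]; exact hgJ p hp

end

end OAC

namespace OAC

noncomputable section

/-! ### The local messages -/

/-- The rows of the gain matrix of the symbols that are present in the sample `y_k[i]`. -/
def maskedGain {M L : ℕ} (h : Fin M → ℂ) (i : Fin (L + 1)) (k : Fin M) :
    Matrix (Fin M ⊕ Fin M) (Fin 2) ℝ :=
  Matrix.of fun p e => gammaVec i k p * gainMatrix h p e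

/-- Both products have the entries `Re (h_m * conj h_l)`. Thus the lower right block of `f_b` is the
one needed for a Gram matrix. -/
theorem beta₂_mul_transpose {M : ℕ} (h : Fin M → ℂ) :
    beta₂ h * (beta₂ h)ᵀ = beta₁ h * (beta₁ h)ᵀ := by
  ext m l
  simp [Matrix.mul_apply, beta₁, beta₂, Fin.sum_univ_two]
  ring

theorem bottomMessage_prec {M L : ℕ} (N₀ : ℝ) (d : Fin M → ℝ) (h : Fin M → ℂ)
    (y : Fin (L + 1) → Fin M → ℂ) (i : Fin (L + 1)) (k : Fin M) :
    (bottomMessage N₀ d h y i k).prec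
      = (2 * d k / N₀) • (maskedGain h i k * (maskedGain h i k)ᵀ) := by
  have h1 : Matrix.fromBlocks (beta₁ h * (beta₁ h)ᵀ) (beta₁ h * (beta₂ h)ᵀ)
      (beta₂ h * (beta₁ h)ᵀ) (beta₁ h * (beta₁ h)ᵀ) = gainMatrix h * (gainMatrix h)ᵀ := by
    rw [gainMatrix, Matrix.transpose_fromRows, Matrix.fromRows_mul_fromCols, beta₂_mul_transpose]
  rw [bottomMessage]
  simp only [h1]
  ext p q
  simp only [Matrix.hadamard_apply, Matrix.smul_apply, gammaMat, Matrix.vecMulVec_apply,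
    Matrix.mul_apply, Matrix.transpose_apply, maskedGain, Matrix.of_apply, smul_eq_mul,
    Finset.mul_sum, Finset.sum_mul]
  exact Finset.sum_congr rfl fun e _ => by ring

theorem bottomMessage_eta {M L : ℕ} (N₀ : ℝ) (d : Fin M → ℝ) (h : Fin M → ℂ)
    (y : Fin (L + 1) → Fin M → ℂ) (i : Fin (L + 1)) (k : Fin M) :
    (bottomMessage N₀ d h y i k).eta
      = (2 * d k / N₀) • (maskedGain h i k *ᵥ fun e => realCoord e (y i k)) := by
  ext p
  rw [bottomMessage]
  rcases p with m | m <;>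
    simp [maskedGain, gainMatrix, Matrix.mulVec, dotProduct, realCoord, Fin.sum_univ_two,
      Matrix.vecHead, Matrix.vecTail] <;> ring

theorem bottomMessage_grad {M L : ℕ} (N₀ : ℝ) (d : Fin M → ℝ) (h : Fin M → ℂ)
    (y : Fin (L + 1) → Fin M → ℂ) (i : Fin (L + 1)) (k : Fin M) (w : Fin M ⊕ Fin M → ℝ)
    (p : Fin M ⊕ Fin M) :
    (bottomMessage N₀ d h y i k).grad w p
      = ∑ e, maskedGain h i k p e * (2 * d k / N₀
        * ((∑ q, maskedGain h i k q e * w q) - realCoord e (y i k))) := by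
  rw [Message.grad, bottomMessage_prec, bottomMessage_eta, Matrix.smul_mulVec,
    ← Matrix.mulVec_mulVec, ← smul_sub, ← Matrix.mulVec_sub, Pi.smul_apply, Matrix.mulVec,
    dotProduct, smul_eq_mul, Finset.mul_sum]
  refine Finset.sum_congr rfl fun e _ => ?_
  simp only [Pi.sub_apply, Matrix.mulVec, dotProduct, Matrix.transpose_apply]
  ring

/-- The coordinates on which the sample `y_k[i]` depends. -/
def sampleSupport {M L : ℕ} (h : Fin M → ℂ) (i : Fin (L + 1)) (k : Fin M) :
    Set (Fin M ⊕ Fin M) :=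
  {p | h (symbolOf p) ≠ 0 ∧ gammaVec i k p ≠ 0}

theorem maskedGain_eq_zero {M L : ℕ} {h : Fin M → ℂ} {i : Fin (L + 1)} {k : Fin M}
    {p : Fin M ⊕ Fin M} (hp : p ∉ sampleSupport h i k) (e : Fin 2) :
    maskedGain h i k p e = 0 := by
  rw [maskedGain, Matrix.of_apply]
  by_cases hγ : gammaVec i k p = 0
  · rw [hγ, zero_mul]
  · have hh : h (symbolOf p) = 0 := by
      by_contra hh; exact hp ⟨hh, hγ⟩
    have : gainMatrix h p e = 0 := by
      rcases p with m | m <;> fin_cases e <;>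
        simp_all [gainMatrix, beta₁, beta₂, symbolOf]
    rw [this, mul_zero]

theorem transpose_maskedGain_mulVec {M L : ℕ} (h : Fin M → ℂ) (i : Fin (L + 1)) (k : Fin M)
    (x : Fin M ⊕ Fin M → ℝ) (e : Fin 2) :
    ((maskedGain h i k)ᵀ *ᵥ x) e = realCoord e
      (∑ m, h m * ((present i k m : ℂ) * ⟨x (Sum.inl m), x (Sum.inr m)⟩)) := by
  rw [realCoord_sum_mul]
  simp only [Matrix.mulVec, dotProduct, Matrix.transpose_apply]
  refine Finset.sum_congr rfl fun p _ => ?_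
  rcases p with m | m <;>
    simp [maskedGain, gammaVec, realVec] <;> ring

/-- Modulo the coordinates in `T`, the sample sees only the symbol `j`. Its two real equations
amount to multiplication of one complex number by `h j`, which is injective when `h j ≠ 0`; hence a
form of rank at most two determines both coordinates of the symbol. -/
theorem bottomMessage_prod {M L : ℕ} {N₀ : ℝ} (hN₀ : 0 < N₀) {d : Fin M → ℝ}
    (hd : ∀ k, 0 < d k) (h : Fin M → ℂ) (y : Fin (L + 1) → Fin M → ℂ) (i : Fin (L + 1))
    (k : Fin M) {a : Message M} {T : Set (Fin M ⊕ Fin M)} (ha : a.GaussianOn T) {j : Fin M}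
    (hj : ∀ p ∈ sampleSupport h i k, symbolOf p ≠ j → p ∈ T) :
    ((bottomMessage N₀ d h y i k).prod a).GaussianOn (T ∪ sampleSupport h i k) := by
  have hc : 0 < 2 * d k / N₀ := div_pos (mul_pos two_pos (hd k)) hN₀
  set N := maskedGain h i k with hN
  have hquad : ∀ x : Fin M ⊕ Fin M → ℝ, x ⬝ᵥ (bottomMessage N₀ d h y i k).prec *ᵥ x
      = 2 * d k / N₀ * ((Nᵀ *ᵥ x) ⬝ᵥ (Nᵀ *ᵥ x)) := by
    intro x
    rw [bottomMessage_prec, Matrix.smul_mulVec, dotProduct_smul, smul_eq_mul,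
      ← Matrix.mulVec_mulVec, Matrix.dotProduct_mulVec, ← Matrix.mulVec_transpose]
  have hnn : ∀ v : Fin 2 → ℝ, 0 ≤ v ⬝ᵥ v := fun v =>
    Finset.sum_nonneg fun e _ => mul_self_nonneg _
  refine ⟨ha.prec.add ?_ ?_ ?_ ?_, ?_⟩
  · rw [bottomMessage_prec, Matrix.transpose_smul, Matrix.transpose_mul, Matrix.transpose_transpose]
  · intro p q hp
    rw [bottomMessage_prec, Matrix.smul_apply, Matrix.mul_apply, Finset.sum_eq_zero, smul_zero]
    intro e _
    rw [maskedGain_eq_zero hp, zero_mul]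
  · intro x
    rw [hquad]
    exact mul_nonneg hc.le (hnn _)
  · rintro x hx ⟨p, hp, hxp⟩
    rw [hquad]
    refine mul_pos hc (lt_of_le_of_ne (hnn _) fun h0 => ?_)
    have hNx : Nᵀ *ᵥ x = 0 := dotProduct_self_eq_zero.1 h0.symm
    have hpj : symbolOf p = j := by
      by_contra hne; exact hxp (hx p (hj p hp hne))
    set w : Fin M → ℂ := fun m => ⟨x (Sum.inl m), x (Sum.inr m)⟩ with hw
    -- Each other symbol drops out for one of three reasons: zero gain, absence from the sample, or
    -- vanishing of `x` on `T`.
    have hsum : ∑ m, h m * ((present i k m : ℂ) * w m) = h j * ((present i k j : ℂ) * w j) := by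
      refine Finset.sum_eq_single j (fun m _ hm => ?_) (by simp)
      by_cases hh : h m = 0
      · rw [hh, zero_mul]
      by_cases hγ : present i k m = 0
      · rw [hγ]; simp
      have h1 : x (Sum.inl m) = 0 := hx _ (hj (Sum.inl m) ⟨hh, hγ⟩ hm)
      have h2 : x (Sum.inr m) = 0 := hx _ (hj (Sum.inr m) ⟨hh, hγ⟩ hm)
      have : w m = 0 := Complex.ext h1 h2
      rw [this]; simp
    have hzero : ∑ m, h m * ((present i k m : ℂ) * w m) = 0 := by
      have h1 := fun e => (transpose_maskedGain_mulVec h i k x e).symm.trans (congrFun hNx e)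
      exact Complex.ext (h1 0) (h1 1)
    rw [hsum] at hzero
    have hhj : h j ≠ 0 := hpj ▸ hp.1
    have hγj : (present i k j : ℂ) ≠ 0 := by
      rw [← hpj]
      have := hp.2
      rcases p with m | m <;> exact Complex.ofReal_ne_zero.2 this
    have hwj : w j = 0 := by simpa [hhj, hγj] using hzero
    apply hxp
    rcases p with m | m
    · have : m = j := hpj
      subst this; exact congrArg Complex.re hwj
    · have : m = j := hpj
      subst this; exact congrArg Complex.im hwj
  · intro p hp
    rw [Set.mem_union, not_or] at hp
    have : (bottomMessage N₀ d h y i k).eta p = 0 := by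
      rw [bottomMessage_eta, Pi.smul_apply, Matrix.mulVec, dotProduct, Finset.sum_eq_zero,
        smul_zero]
      intro e _
      rw [maskedGain_eq_zero hp.2, zero_mul]
    change (bottomMessage N₀ d h y i k).eta p + a.eta p = 0
    rw [this, ha.eta p hp.1, add_zero]

theorem topMessage_of_last {M : ℕ} (E : Fin M → ℂ) {D : Fin M → ℝ} (hD : ∀ m, 0 < D m)
    {k : Fin M} (hk : (k : ℕ) + 1 = M) :
    topMessage E D k = ⟨fun p => 2 / D (symbolOf p) * realVec E p,
      Matrix.diagonal fun p => 2 / D (symbolOf p)⟩ := by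
  have hp : pinv ((1 / 2 : ℝ) • Matrix.diagonal (Sum.elim D D))
      = Matrix.diagonal fun p => 2 / D (symbolOf p) := by
    apply pinv_eq_of_mul_eq_one
    rw [Matrix.smul_mul, Matrix.diagonal_mul_diagonal, ← Matrix.diagonal_one,
      ← Matrix.diagonal_smul]
    congr 1
    ext p
    have := (hD (symbolOf p)).ne'
    rcases p with m | m <;> simp [symbolOf] at this ⊢ <;> field_simp
  rw [topMessage, if_pos hk, Message.ofMoments, hp]
  congr 1
  ext p
  rw [Matrix.mulVec_diagonal]
  rfl

theorem topMessage_prod_of_last {M : ℕ} (E : Fin M → ℂ) {D : Fin M → ℝ} (hD : ∀ m, 0 < D m)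
    {k : Fin M} (hk : (k : ℕ) + 1 = M) {a : Message M} {T : Set (Fin M ⊕ Fin M)}
    (ha : a.GaussianOn T) : ((topMessage E D k).prod a).GaussianOn Set.univ := by
  have hpd : (Matrix.diagonal fun p : Fin M ⊕ Fin M => 2 / D (symbolOf p)).PosDef :=
    Matrix.PosDef.diagonal fun p => div_pos two_pos (hD _)
  rw [topMessage_of_last E hD hk]
  refine ⟨?_, fun p hp => absurd trivial hp⟩
  have := ha.prec.add (U := Set.univ) (Matrix.diagonal_transpose fun p => 2 / D (symbolOf p))
    (fun p q hp => absurd trivial hp) ?_ ?_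
  · rwa [Set.union_univ] at this
  · intro x
    simpa using hpd.posSemidef.dotProduct_mulVec_nonneg x
  · rintro x - ⟨p, -, hxp⟩
    have := hpd.dotProduct_mulVec_pos (x := x) fun h0 => hxp (congrFun h0 p)
    simpa using this

theorem topMessage_of_not_last {M : ℕ} (E : Fin M → ℂ) (D : Fin M → ℝ) {k : Fin M}
    (hk : (k : ℕ) + 1 ≠ M) : topMessage E D k = Message.flat M := by
  rw [topMessage, if_neg hk]

theorem Message.prod_assoc {M : ℕ} (a b c : Message M) :
    (a.prod b).prod c = a.prod (b.prod c) := by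
  simp only [Message.prod, add_assoc]

theorem Message.prod_comm {M : ℕ} (a b : Message M) : a.prod b = b.prod a := by
  simp only [Message.prod, add_comm]

theorem Message.flat_prod {M : ℕ} (a : Message M) : (Message.flat M).prod a = a := by
  simp only [Message.prod, Message.flat, zero_add]

end

end OAC

namespace OAC

noncomputable section

/-! ### The chain of variables -/

theorem ofSymbol_iff {M : ℕ} (j : Fin M) (p : Fin M ⊕ Fin M) : ofSymbol j p ↔ symbolOf p = j := by
  rcases p with m | m <;> simp [ofSymbol, symbolOf]

theorem nodeDevice_val (M : ℕ) [NeZero M] (n : ℕ) : (nodeDevice M n : ℕ) = n % M := by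
  simp [nodeDevice, Fin.ofNat]

theorem nodeTime_val {M L n : ℕ} (hn : n < M * (L + 1)) : (nodeTime M L n : ℕ) = n / M := by
  have : n / M < L + 1 := Nat.div_lt_of_lt_mul hn
  simp [nodeTime, Fin.ofNat, Nat.mod_eq_of_lt this]

/-- The time index of the coordinate `p` in the `n`-th variable of the chain. -/
def nodeSlot (M : ℕ) [NeZero M] (n : ℕ) (p : Fin M ⊕ Fin M) : ℕ :=
  slot (n / M) (nodeDevice M n) (symbolOf p)

/-- Either the device index grows by one within the same time index, or it wraps from the last
device to the first and the time index grows. In both cases exactly the position of the new device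
advances. -/
theorem nodeSlot_succ (M : ℕ) [NeZero M] (n : ℕ) (p : Fin M ⊕ Fin M) :
    nodeSlot M (n + 1) p
      = if symbolOf p = nodeDevice M (n + 1) then nodeSlot M n p + 1 else nodeSlot M n p := by
  have hM : 0 < M := Nat.pos_of_neZero M
  have hm : (symbolOf p : ℕ) < M := (symbolOf p).2
  have hr : n % M < M := Nat.mod_lt _ hM
  have hn := Nat.div_add_mod n M
  simp only [nodeSlot, slot, Fin.le_def, Fin.ext_iff, nodeDevice_val]
  rcases Nat.lt_or_ge (n % M + 1) M with h | h
  · have h1 : (n + 1) / M = n / M := by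
      rw [← hn, Nat.add_assoc, Nat.mul_add_div hM, Nat.mul_add_div hM, Nat.div_eq_of_lt h,
        Nat.div_eq_of_lt hr]
    have h2 : (n + 1) % M = n % M + 1 := by
      conv_lhs => rw [← hn, Nat.add_assoc, Nat.mul_add_mod, Nat.mod_eq_of_lt h]
    rw [h1, h2]
    split_ifs <;> omega
  · have h0 : n % M + 1 = M := by omega
    have hn' : n + 1 = M * (n / M + 1) := by rw [Nat.mul_add, mul_one]; omega
    have h1 : (n + 1) / M = n / M + 1 := by rw [hn', Nat.mul_div_cancel_left _ hM]
    have h2 : (n + 1) % M = 0 := by rw [hn', Nat.mul_mod_right]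
    rw [h1, h2]
    split_ifs <;> omega

theorem nodeSlot_mono (M : ℕ) [NeZero M] (p : Fin M ⊕ Fin M) : Monotone fun n => nodeSlot M n p :=
  monotone_nat_of_le_succ fun n => by
    rw [nodeSlot_succ]; split_ifs <;> omega

/-- The mask removes exactly the fictitious symbols of times `0` and `L + 1`. For `L = 0` the two
boundary cases of `present` would collide. -/
theorem gammaVec_eq {M L : ℕ} (hL : 0 < L) (i : Fin (L + 1)) (k : Fin M) (p : Fin M ⊕ Fin M) :
    gammaVec i k p
      = if 1 ≤ slot (i : ℕ) k (symbolOf p) ∧ slot (i : ℕ) k (symbolOf p) ≤ L then 1 else 0 := by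
  have hi := i.2
  have key : ∀ m : Fin M, present i k m
      = if 1 ≤ slot (i : ℕ) k m ∧ slot (i : ℕ) k m ≤ L then 1 else 0 := by
    intro m
    simp only [present, slot, Fin.le_def, Fin.lt_def]
    split_ifs <;> first | rfl | omega
  rcases p with m | m <;> exact key m

/-- The value of the `n`-th variable of the chain for given values of all symbols. -/
def nodeView {M : ℕ} [NeZero M] (X : ℕ → Fin M ⊕ Fin M → ℝ) (n : ℕ) : Fin M ⊕ Fin M → ℝ :=
  fun p => X (nodeSlot M n p) p

/-- The gradient of the sum of the quadratic forms of the local messages at the nodes in `s`. -/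
def chainGrad {M : ℕ} [NeZero M] (ℓ : ℕ → Message M) (s : Finset ℕ)
    (X : ℕ → Fin M ⊕ Fin M → ℝ) (t : ℕ) (p : Fin M ⊕ Fin M) : ℝ :=
  ∑ n ∈ s, if t = nodeSlot M n p then (ℓ n).grad (nodeView X n) p else 0

/-- Minimizing the sum of the quadratic forms at the nodes in `s` over all symbols that do not
belong to the variable `n` gives the quadratic form of the message `a`. -/
def IsMessageOf {M : ℕ} [NeZero M] (ℓ : ℕ → Message M) (s : Finset ℕ) (n : ℕ)
    (a : Message M) : Prop :=
  ∀ w, ∃ X, nodeView X n = w ∧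
    ∀ t p, chainGrad ℓ s X t p = if t = nodeSlot M n p then a.grad w p else 0

section Chain

variable {M : ℕ} [NeZero M] {ℓ : ℕ → Message M} {s : Finset ℕ} {n : ℕ} {a : Message M}

theorem chainGrad_congr {X X' : ℕ → Fin M ⊕ Fin M → ℝ}
    (h : ∀ n ∈ s, nodeView X n = nodeView X' n) : chainGrad ℓ s X = chainGrad ℓ s X' := by
  ext t p
  exact Finset.sum_congr rfl fun n hn => by rw [h n hn]

theorem IsMessageOf.empty : IsMessageOf ℓ ∅ n (Message.flat M) := fun w =>
  ⟨fun _ p => w p, rfl, fun t p => by simp [chainGrad, Message.grad_flat]⟩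

/-- Multiplication with the local message. -/
theorem IsMessageOf.insert (h : IsMessageOf ℓ s n a) (hn : n ∉ s) :
    IsMessageOf ℓ (insert n s) n ((ℓ n).prod a) := by
  intro w
  obtain ⟨X, hX, hg⟩ := h w
  refine ⟨X, hX, fun t p => ?_⟩
  have : chainGrad ℓ (Insert.insert n s) X t p
      = (if t = nodeSlot M n p then (ℓ n).grad (nodeView X n) p else 0) + chainGrad ℓ s X t p :=
    Finset.sum_insert hn
  rw [this, hg, hX, Message.grad_prod]
  split_ifs
  · rfl
  · rw [add_zero]

/-- Passing a message to a neighbour that differs in the symbol `j`. -/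
theorem IsMessageOf.replaceSymbol (h : IsMessageOf ℓ s n a) {T : Set (Fin M ⊕ Fin M)}
    (ha : a.GaussianOn T) {n' : ℕ} {j : Fin M}
    (hslot : ∀ p, symbolOf p ≠ j → nodeSlot M n' p = nodeSlot M n p)
    (hne : ∀ p, symbolOf p = j → ∀ l ∈ s, nodeSlot M l p ≠ nodeSlot M n' p) :
    IsMessageOf ℓ s n' (a.replaceSymbol j) := by
  intro w'
  obtain ⟨w, hw, hout, hin⟩ := (ha.replaceSymbol j).2 w'
  simp only [ofSymbol_iff] at hw hout hin
  obtain ⟨X, hX, hg⟩ := h w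
  -- Only the new copy of the symbol `j` is overwritten. By `hne` no node in `s` sees it, so the
  -- gradient is unchanged.
  let X' : ℕ → Fin M ⊕ Fin M → ℝ := fun t p =>
    if symbolOf p = j ∧ t = nodeSlot M n' p then w' p else X t p
  have hview : ∀ l ∈ s, nodeView X' l = nodeView X l := by
    intro l hl
    ext p
    refine if_neg ?_
    rintro ⟨hp, ht⟩
    exact hne p hp l hl ht
  refine ⟨X', ?_, fun t p => ?_⟩
  · ext p
    by_cases hp : symbolOf p = j
    · exact if_pos ⟨hp, rfl⟩
    · rw [← hw p hp, ← hX]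
      refine (if_neg fun h => hp h.1).trans ?_
      rw [hslot p hp]; rfl
  · rw [chainGrad_congr hview, hg]
    by_cases hp : symbolOf p = j
    · rw [(hin p hp).1, (hin p hp).2, ite_self, ite_self]
    · rw [hslot p hp, hout p hp]

/-- Combining the messages from both sides. -/
theorem IsMessageOf.union {s' : Finset ℕ} {b : Message M} (h : IsMessageOf ℓ s n a)
    (h' : IsMessageOf ℓ s' n b) (hs : ∀ l ∈ s, l ≤ n) (hs' : ∀ l ∈ s', n < l) :
    IsMessageOf ℓ (s ∪ s') n (a.prod b) := by
  intro w
  obtain ⟨X, hX, hg⟩ := h w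
  obtain ⟨X', hX', hg'⟩ := h' w
  -- The extensions are glued along the variable `n`: by monotonicity, nodes to the left use slots
  -- up to that of `n`, nodes to the right use later ones, and a shared slot is one of `n`, where
  -- both equal `w`.
  let Y : ℕ → Fin M ⊕ Fin M → ℝ := fun t p => if t ≤ nodeSlot M n p then X t p else X' t p
  have hY : ∀ l, l ≤ n → nodeView Y l = nodeView X l := by
    intro l hl
    ext p
    exact if_pos (nodeSlot_mono M p hl)
  have hY' : ∀ l, n ≤ l → nodeView Y l = nodeView X' l := by
    intro l hl
    ext p
    rcases (nodeSlot_mono M p hl).eq_or_lt with h | h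
    · simp only at h
      simp only [nodeView, Y, ← h]
      rw [if_pos le_rfl]
      exact congrFun (hX.trans hX'.symm) p
    · exact if_neg (by simpa using h)
  refine ⟨Y, (hY n le_rfl).trans hX, fun t p => ?_⟩
  have hdisj : Disjoint s s' := Finset.disjoint_left.2 fun l hl hl' =>
    absurd (hs l hl) (hs' l hl').not_ge
  have hsum : chainGrad ℓ (s ∪ s') Y t p = chainGrad ℓ s Y t p + chainGrad ℓ s' Y t p :=
    Finset.sum_union hdisj
  rw [hsum, chainGrad_congr fun l hl => hY l (hs l hl),
    chainGrad_congr (s := s') fun l hl => hY' l (hs' l hl).le, hg, hg', Message.grad_prod]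
  split_ifs
  · rfl
  · rw [add_zero]

end Chain

/-! ### The forward and the backward pass -/

section Passes

variable {M L : ℕ} [NeZero M] {N₀ : ℝ} {d : Fin M → ℝ} {h : Fin M → ℂ} {E : Fin M → ℂ}
  {D : Fin M → ℝ} {y : Fin (L + 1) → Fin M → ℂ}

/-- The coordinates on which the sample at the `n`-th node of the chain depends. -/
def nodeSupport {M : ℕ} [NeZero M] (L : ℕ) (h : Fin M → ℂ) (n : ℕ) : Set (Fin M ⊕ Fin M) :=
  {p | h (symbolOf p) ≠ 0 ∧ 1 ≤ nodeSlot M n p ∧ nodeSlot M n p ≤ L}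

theorem sampleSupport_node (hL : 0 < L) (h : Fin M → ℂ) {n : ℕ} (hn : n < M * (L + 1)) :
    sampleSupport h (nodeTime M L n) (nodeDevice M n) = nodeSupport L h n := by
  ext p
  simp only [sampleSupport, nodeSupport, Set.mem_ofPred_eq, gammaVec_eq hL, nodeTime_val hn,
    nodeSlot]
  refine and_congr_right fun _ => ?_
  split_ifs with hc <;> simp [hc]

/-- The messages that enter a node leave at most one symbol of its sample undetermined. -/
def Message.Enters (L : ℕ) (h : Fin M → ℂ) (n : ℕ) (a : Message M) : Prop :=
  ∃ T, a.GaussianOn T ∧ ∃ j, ∀ p ∈ nodeSupport L h n, symbolOf p ≠ j → p ∈ T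

theorem Message.Enters.localMessage_prod (hL : 0 < L) (hN₀ : 0 < N₀) (hd : ∀ k, 0 < d k)
    (hD : ∀ m, 0 < D m) {n : ℕ} (hn : n < M * (L + 1)) {a : Message M} (ha : a.Enters L h n) :
    ∃ T, ((localMessage N₀ d h E D y n).prod a).GaussianOn T ∧ nodeSupport L h n ⊆ T ∧
      ((nodeDevice M n : ℕ) + 1 = M → T = Set.univ) := by
  obtain ⟨T, haT, j, hj⟩ := ha
  rw [← sampleSupport_node hL h hn] at hj ⊢
  have h1 := bottomMessage_prod hN₀ hd h y (nodeTime M L n) (nodeDevice M n) haT hj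
  have hprod : (localMessage N₀ d h E D y n).prod a = (topMessage E D (nodeDevice M n)).prod
      ((bottomMessage N₀ d h y (nodeTime M L n) (nodeDevice M n)).prod a) := by
    rw [localMessage, Message.prod_comm (bottomMessage _ _ _ _ _ _), Message.prod_assoc]
  rw [hprod]
  by_cases hk : (nodeDevice M n : ℕ) + 1 = M
  · exact ⟨Set.univ, topMessage_prod_of_last E hD hk h1, Set.subset_univ _, fun _ => rfl⟩
  · rw [topMessage_of_not_last E D hk, Message.flat_prod]
    exact ⟨_, h1, Set.subset_union_right, fun hk' => absurd hk' hk⟩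

/-- All effective symbols of the old sample are determined, and the next sample differs from it in
`j` alone; so `j` is the only symbol that can be undetermined. -/
theorem Message.GaussianOn.enters_replaceSymbol {a : Message M} {T : Set (Fin M ⊕ Fin M)}
    (ha : a.GaussianOn T) {n n' : ℕ} (hT : nodeSupport L h n ⊆ T) {j : Fin M}
    (hslot : ∀ p, symbolOf p ≠ j → nodeSlot M n' p = nodeSlot M n p) :
    (a.replaceSymbol j).Enters L h n' := by
  refine ⟨_, (ha.replaceSymbol j).1, j, fun p hp hpj => ⟨hT ⟨hp.1, ?_⟩, ?_⟩⟩
  · rw [← hslot p hpj]; exact hp.2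
  · rw [Set.mem_ofPred_eq, ofSymbol_iff]; exact hpj

theorem forwardMessage_spec (hL : 0 < L) (hN₀ : 0 < N₀) (hd : ∀ k, 0 < d k)
    (hD : ∀ m, 0 < D m) : ∀ n, n < M * (L + 1) →
    (forwardMessage N₀ d h E D y n).Enters L h n ∧
      IsMessageOf (localMessage N₀ d h E D y) (Finset.range n) n
        (forwardMessage N₀ d h E D y n) := by
  intro n
  induction n with
  | zero =>
    refine fun _ => ⟨⟨∅, Message.GaussianOn.flat, nodeDevice M 0, fun p hp hpj => ?_⟩,
      IsMessageOf.empty⟩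
    -- In the first variable only the first device has reached time one; the other positions hold
    -- time `0` and are masked.
    have h1 := hp.2.1
    refine absurd (Fin.ext ?_) hpj
    simp only [nodeSlot, slot, Fin.le_def, nodeDevice_val, Nat.zero_div, Nat.zero_mod] at h1 ⊢
    split_ifs at h1 <;> omega
  | succ n ih =>
    intro hn
    obtain ⟨h1, h2⟩ := ih (by omega)
    obtain ⟨T, hT, hsub, -⟩ := h1.localMessage_prod (E := E) (y := y) hL hN₀ hd hD (by omega)
    have hslot : ∀ p, symbolOf p ≠ nodeDevice M (n + 1) →
        nodeSlot M (n + 1) p = nodeSlot M n p := fun p hp => by rw [nodeSlot_succ, if_neg hp]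
    have hlt : ∀ p, symbolOf p = nodeDevice M (n + 1) → ∀ l ≤ n,
        nodeSlot M l p ≠ nodeSlot M (n + 1) p := fun p hp l hl => by
      have : nodeSlot M l p ≤ nodeSlot M n p := nodeSlot_mono M p hl
      rw [nodeSlot_succ, if_pos hp]; omega
    refine ⟨hT.enters_replaceSymbol hsub hslot, ?_⟩
    have h3 := h2.insert Finset.notMem_range_self
    rw [← Finset.range_add_one] at h3
    exact h3.replaceSymbol hT hslot
      (fun p hp l hl => hlt p hp l (Nat.lt_succ_iff.1 (Finset.mem_range.1 hl)))

theorem backwardMessage_spec (hL : 0 < L) (hN₀ : 0 < N₀) (hd : ∀ k, 0 < d k)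
    (hD : ∀ m, 0 < D m) : ∀ r n, n + r + 1 = M * (L + 1) →
    (backwardMessage N₀ d h E D y r).Enters L h n ∧
      IsMessageOf (localMessage N₀ d h E D y) (Finset.Ico (n + 1) (M * (L + 1))) n
        (backwardMessage N₀ d h E D y r) := by
  intro r
  induction r with
  | zero =>
    intro n hn
    have hM : 0 < M := Nat.pos_of_neZero M
    rw [show Finset.Ico (n + 1) (M * (L + 1)) = ∅ by rw [Finset.Ico_eq_empty]; omega]
    refine ⟨⟨∅, Message.GaussianOn.flat, nodeDevice M 0, fun p hp _ => ?_⟩, IsMessageOf.empty⟩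
    -- Every position of the last variable has time `L + 1`, so its sample support is empty.
    have h1 := hp.2.2
    have hn' : n = M * L + (M - 1) := by rw [Nat.mul_add] at hn; omega
    have hdiv : n / M = L := by
      rw [hn', Nat.mul_add_div hM, Nat.div_eq_of_lt (by omega), Nat.add_zero]
    have hmod : n % M = M - 1 := by
      rw [hn', Nat.mul_add_mod, Nat.mod_eq_of_lt (by omega)]
    have hm : (symbolOf p : ℕ) < M := (symbolOf p).2
    rw [nodeSlot, slot, if_pos (by rw [Fin.le_def, nodeDevice_val]; omega), hdiv] at h1
    omega
  | succ r ih =>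
    intro n hn
    obtain ⟨h1, h2⟩ := ih (n + 1) (by omega)
    obtain ⟨T, hT, hsub, -⟩ := h1.localMessage_prod (E := E) (y := y) hL hN₀ hd hD (by omega)
    have hslot : ∀ p, symbolOf p ≠ nodeDevice M (n + 1) →
        nodeSlot M n p = nodeSlot M (n + 1) p := fun p hp => by rw [nodeSlot_succ, if_neg hp]
    have hlt : ∀ p, symbolOf p = nodeDevice M (n + 1) → ∀ l, n + 1 ≤ l →
        nodeSlot M l p ≠ nodeSlot M n p := fun p hp l hl => by
      have : nodeSlot M (n + 1) p ≤ nodeSlot M l p := nodeSlot_mono M p hl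
      rw [nodeSlot_succ, if_pos hp] at this; omega
    have hr : M * (L + 1) - 1 - r = n + 1 := by omega
    rw [backwardMessage, hr]
    refine ⟨hT.enters_replaceSymbol hsub hslot, ?_⟩
    have h3 := h2.insert (by simp)
    have hIco : insert (n + 1) (Finset.Ico (n + 1 + 1) (M * (L + 1)))
        = Finset.Ico (n + 1) (M * (L + 1)) := by
      ext l; simp only [Finset.mem_insert, Finset.mem_Ico]; omega
    rw [hIco] at h3
    exact h3.replaceSymbol hT hslot (fun p hp l hl => hlt p hp l (Finset.mem_Ico.1 hl).1)

theorem symbolNode_lt (i : Fin L) : symbolNode (M := M) i + M < M * (L + 1) := by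
  have hM : 0 < M := Nat.pos_of_neZero M
  have : M * ((i : ℕ) + 1) ≤ M * L := Nat.mul_le_mul_left M i.2
  rw [Nat.mul_add] at this ⊢
  rw [symbolNode]
  omega

theorem nodeDevice_symbolNode (i : Fin L) : (nodeDevice M (symbolNode (M := M) i) : ℕ) + 1 = M := by
  have hM : 0 < M := Nat.pos_of_neZero M
  rw [nodeDevice_val, symbolNode, Nat.mul_add_mod, Nat.mod_eq_of_lt (by omega)]
  omega

theorem nodeSlot_symbolNode (i : Fin L) (p : Fin M ⊕ Fin M) :
    nodeSlot M (symbolNode (M := M) i) p = (i : ℕ) + 1 := by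
  have hM : 0 < M := Nat.pos_of_neZero M
  have hm : (symbolOf p : ℕ) < M := (symbolOf p).2
  have hk := nodeDevice_symbolNode (M := M) i
  rw [nodeSlot, slot, if_pos (by rw [Fin.le_def]; omega), symbolNode, Nat.mul_add_div hM,
    Nat.div_eq_of_lt (by omega), Nat.add_zero]

/-- The prior enters at `W_{M,i}` and makes the form definite on all coordinates; the backward
message only adds a nonnegative form. -/
theorem marginalMessage_posDef (hN₀ : 0 < N₀) (hd : ∀ k, 0 < d k) (hD : ∀ m, 0 < D m)
    (i : Fin L) : (marginalMessage N₀ d h E D y i).prec.PosDef := by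
  have hL : 0 < L := i.pos
  have hlt := symbolNode_lt (M := M) i
  obtain ⟨T, hT, -, huniv⟩ := (forwardMessage_spec (h := h) (E := E) (y := y) hL hN₀ hd hD
    (symbolNode (M := M) i) (by omega)).1.localMessage_prod (E := E) (y := y) hL hN₀ hd hD
      (by omega)
  obtain ⟨⟨T', hT', -⟩, -⟩ := backwardMessage_spec (h := h) (E := E) (y := y) hL hN₀ hd hD
    (M * (L + 1) - 1 - symbolNode (M := M) i) (symbolNode (M := M) i) (by omega)
  rw [huniv (nodeDevice_symbolNode i)] at hT
  have := hT.prec.add hT'.prec.symm hT'.prec.eq_zero hT'.prec.nonneg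
    (fun x hx hx' => absurd (hx _ trivial) hx'.choose_spec.2)
  rw [Set.univ_union, add_comm] at this
  exact this.posDef

theorem isMessageOf_marginalMessage (hN₀ : 0 < N₀) (hd : ∀ k, 0 < d k) (hD : ∀ m, 0 < D m)
    (i : Fin L) : IsMessageOf (localMessage N₀ d h E D y) (Finset.range (M * (L + 1)))
      (symbolNode (M := M) i) (marginalMessage N₀ d h E D y i) := by
  have hL : 0 < L := i.pos
  have hlt := symbolNode_lt (M := M) i
  have hf := (forwardMessage_spec (h := h) (E := E) (y := y) hL hN₀ hd hD
    (symbolNode (M := M) i) (by omega)).2.insert Finset.notMem_range_self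
  have hb := (backwardMessage_spec (h := h) (E := E) (y := y) hL hN₀ hd hD
    (M * (L + 1) - 1 - symbolNode (M := M) i) (symbolNode (M := M) i) (by omega)).2
  rw [← Finset.range_add_one] at hf
  have := hf.union hb (fun l hl => Nat.lt_succ_iff.1 (Finset.mem_range.1 hl))
    (fun l hl => (Finset.mem_Ico.1 hl).1)
  have hs : Finset.range (symbolNode (M := M) i + 1)
      ∪ Finset.Ico (symbolNode (M := M) i + 1) (M * (L + 1)) = Finset.range (M * (L + 1)) := by
    ext l; simp only [Finset.mem_union, Finset.mem_range, Finset.mem_Ico]; omega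
  rwa [hs] at this

end Passes

end

end OAC

namespace OAC

noncomputable section

/-! ### The messages and the joint posterior -/

section Joint

variable {M L : ℕ} {N₀ : ℝ} {d : Fin M → ℝ} {h : Fin M → ℂ} {E : Fin M → ℂ}
  {D : Fin M → ℝ} {y : Fin (L + 1) → Fin M → ℂ}

theorem jointPrec_mulVec_sub_jointEta (u : SymbolIndex M L → ℝ) (t : Fin L)
    (p : Fin M ⊕ Fin M) :
    (jointPrec L N₀ d h D *ᵥ u - jointEta N₀ d h E D y) (t, p)
      = (∑ i : Fin (L + 1), ∑ k : Fin M, if (t : ℕ) + 1 = slot (i : ℕ) k (symbolOf p) then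
          ∑ e, gainMatrix h p e * (2 * d k / N₀
            * ((channelMatrix L h *ᵥ u) ((i, k), e) - realCoord e (y i k))) else 0)
        + 2 / D (symbolOf p) * (u (t, p) - realVec E p) := by
  have h1 : jointPrec L N₀ d h D *ᵥ u - jointEta N₀ d h E D y
      = (channelMatrix L h)ᵀ *ᵥ (samplePrec L N₀ d * (channelMatrix L h *ᵥ u - sampleCoords y))
        + symbolPrec L D * (u - symbolMean L E) := by
    have h2 : ∀ v : SampleIndex M L → ℝ,
        Matrix.diagonal (samplePrec L N₀ d) *ᵥ v = samplePrec L N₀ d * v := by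
      intro v; ext n; rw [Matrix.mulVec_diagonal]; rfl
    have h3 : Matrix.diagonal (symbolPrec L D) *ᵥ u = symbolPrec L D * u := by
      ext n; rw [Matrix.mulVec_diagonal]; rfl
    rw [jointPrec, jointEta, Matrix.add_mulVec, ← Matrix.mulVec_mulVec, ← Matrix.mulVec_mulVec,
      h2, h3, mul_sub, Matrix.mulVec_sub, mul_sub]
    abel
  rw [h1, Pi.add_apply]
  congr 1
  simp only [Matrix.mulVec, dotProduct, Matrix.transpose_apply, channelMatrix, Matrix.of_apply]
  rw [Fintype.sum_prod_type, Fintype.sum_prod_type]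
  refine Finset.sum_congr rfl fun i _ => Finset.sum_congr rfl fun k _ => ?_
  by_cases hs : (t : ℕ) + 1 = slot (i : ℕ) k (symbolOf p)
  · rw [if_pos hs]
    refine Finset.sum_congr rfl fun e _ => ?_
    rw [if_pos hs.symm]
    rfl
  · rw [if_neg hs]
    refine Finset.sum_eq_zero fun e _ => ?_
    rw [if_neg (Ne.symm hs), zero_mul]

/-- The mask and the index range of `channelMatrix` discard the same slots, so the values of `X` at
times `0` and `L + 1` are irrelevant. -/
theorem sum_maskedGain_mul (hL : 0 < L) (X : ℕ → Fin M ⊕ Fin M → ℝ) (i : Fin (L + 1)) (k : Fin M)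
    (e : Fin 2) :
    ∑ q, maskedGain h i k q e * X (slot (i : ℕ) k (symbolOf q)) q
      = (channelMatrix L h *ᵥ fun a => X ((a.1 : ℕ) + 1) a.2) ((i, k), e) := by
  simp only [Matrix.mulVec, dotProduct, channelMatrix, Matrix.of_apply]
  rw [Fintype.sum_prod_type_right]
  refine Finset.sum_congr rfl fun q _ => ?_
  rw [maskedGain, Matrix.of_apply, gammaVec_eq hL]
  by_cases hs : 1 ≤ slot (i : ℕ) k (symbolOf q) ∧ slot (i : ℕ) k (symbolOf q) ≤ L
  · rw [if_pos hs, one_mul,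
      Finset.sum_eq_single (⟨slot (i : ℕ) k (symbolOf q) - 1, by omega⟩ : Fin L)]
    · have h1 : slot (i : ℕ) k (symbolOf q) - 1 + 1 = slot (i : ℕ) k (symbolOf q) := by omega
      simp only [h1, if_true]
    · intro j _ hj
      rw [if_neg, zero_mul]
      intro h0
      exact hj (Fin.ext (by simp [h0]))
    · simp
  · rw [if_neg hs, zero_mul, zero_mul, Finset.sum_eq_zero]
    intro j _
    have hj := j.2
    rw [if_neg, zero_mul]
    intro h0
    simp only at h0
    exact hs ⟨by omega, by omega⟩

/-- Each sample contributes its term of `Hᵀ R (H u - y)`, and the prior of time `t` is collected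
once, at the last device. The chain also places a prior on the fictitious symbols of time `L + 1`;
it affects no gradient at times `1` to `L`. -/
theorem chainGrad_localMessage [NeZero M] (hL : 0 < L) (hD : ∀ m, 0 < D m)
    (X : ℕ → Fin M ⊕ Fin M → ℝ) (t : Fin L) (p : Fin M ⊕ Fin M) :
    chainGrad (localMessage N₀ d h E D y) (Finset.range (M * (L + 1))) X ((t : ℕ) + 1) p
      = (jointPrec L N₀ d h D *ᵥ (fun a => X ((a.1 : ℕ) + 1) a.2) - jointEta N₀ d h E D y)
        (t, p) := by
  have hM : 0 < M := Nat.pos_of_neZero M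
  have hsum : ∀ f : ℕ → ℝ, ∑ n ∈ Finset.range (M * (L + 1)), f n
      = ∑ i : Fin (L + 1), ∑ k : Fin M, f ((k : ℕ) + M * (i : ℕ)) := by
    intro f
    rw [mul_comm, Finset.sum_range, ← finProdFinEquiv.sum_comp, Fintype.sum_prod_type]
    rfl
  have hdiv : ∀ (i : Fin (L + 1)) (k : Fin M), ((k : ℕ) + M * (i : ℕ)) / M = i := fun i k => by
    rw [Nat.add_mul_div_left _ _ hM, Nat.div_eq_of_lt k.2, Nat.zero_add]
  have hdev : ∀ (i : Fin (L + 1)) (k : Fin M), nodeDevice M ((k : ℕ) + M * (i : ℕ)) = k :=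
    fun i k => Fin.ext (by rw [nodeDevice_val, Nat.add_mul_mod_self_left, Nat.mod_eq_of_lt k.2])
  have htime : ∀ (i : Fin (L + 1)) (k : Fin M), nodeTime M L ((k : ℕ) + M * (i : ℕ)) = i := by
    intro i k
    apply Fin.ext
    rw [nodeTime_val, hdiv]
    have : M * (i : ℕ) ≤ M * L := Nat.mul_le_mul_left M (Nat.lt_succ_iff.1 i.2)
    have := k.2
    rw [Nat.mul_add]; omega
  have hslot : ∀ (i : Fin (L + 1)) (k : Fin M) (q : Fin M ⊕ Fin M),
      nodeSlot M ((k : ℕ) + M * (i : ℕ)) q = slot (i : ℕ) k (symbolOf q) := by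
    intro i k q
    rw [nodeSlot, hdiv, hdev]
  rw [jointPrec_mulVec_sub_jointEta, chainGrad, hsum]
  have hsplit : ∀ (i : Fin (L + 1)) (k : Fin M),
      (if (t : ℕ) + 1 = nodeSlot M ((k : ℕ) + M * (i : ℕ)) p then
        (localMessage N₀ d h E D y ((k : ℕ) + M * (i : ℕ))).grad
          (nodeView X ((k : ℕ) + M * (i : ℕ))) p else 0)
      = (if (t : ℕ) + 1 = slot (i : ℕ) k (symbolOf p) then
          ∑ e, gainMatrix h p e * (2 * d k / N₀
            * ((channelMatrix L h *ᵥ fun a => X ((a.1 : ℕ) + 1) a.2) ((i, k), e)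
              - realCoord e (y i k))) else 0)
        + if (k : ℕ) + 1 = M ∧ t.castSucc = i then
            2 / D (symbolOf p) * (X ((t : ℕ) + 1) p - realVec E p) else 0 := by
    intro i k
    have hlast : (k : ℕ) + 1 = M → slot (i : ℕ) k (symbolOf p) = (i : ℕ) + 1 := fun hk => by
      have := (symbolOf p).2
      rw [slot, if_pos (by rw [Fin.le_def]; omega)]
    rw [hslot]
    by_cases hs : (t : ℕ) + 1 = slot (i : ℕ) k (symbolOf p)
    · rw [if_pos hs, if_pos hs, localMessage, htime, hdev, Message.grad_prod, Pi.add_apply,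
        bottomMessage_grad]
      congr 1
      · refine Finset.sum_congr rfl fun e _ => ?_
        have hview : ∀ q, nodeView X ((k : ℕ) + M * (i : ℕ)) q
            = X (slot (i : ℕ) k (symbolOf q)) q := fun q => by rw [nodeView, hslot]
        simp only [hview]
        rw [sum_maskedGain_mul hL, maskedGain, Matrix.of_apply, gammaVec_eq hL, if_pos, one_mul]
        have := t.2
        omega
      · by_cases hk : (k : ℕ) + 1 = M
        · have hti : t.castSucc = i := Fin.ext (by
            have := hlast hk
            simp only [Fin.val_castSucc]
            omega)
          rw [if_pos ⟨hk, hti⟩, topMessage_of_last E hD hk, Message.grad, Pi.sub_apply,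
            Matrix.mulVec_diagonal, nodeView, hslot, ← hs, mul_sub]
        · rw [if_neg fun h0 => hk h0.1, topMessage_of_not_last E D hk, Message.grad_flat]
          rfl
    · rw [if_neg hs, if_neg hs, if_neg, add_zero]
      rintro ⟨hk, hti⟩
      apply hs
      rw [hlast hk, ← hti, Fin.val_castSucc]
  simp only [hsplit, Finset.sum_add_distrib]
  congr 1
  rw [Finset.sum_eq_single t.castSucc, Finset.sum_eq_single (⟨M - 1, by omega⟩ : Fin M)]
  · rw [if_pos ⟨by simp only; omega, rfl⟩]
  · intro k _ hk
    rw [if_neg]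
    rintro ⟨h1, -⟩
    exact hk (Fin.ext (by simp only; omega))
  · simp
  · intro i _ hi
    refine Finset.sum_eq_zero fun k _ => if_neg fun h0 => hi h0.2.symm
  · simp

theorem exists_joint_of_marginalMessage [NeZero M] (hN₀ : 0 < N₀) (hd : ∀ k, 0 < d k)
    (hD : ∀ m, 0 < D m) (i : Fin L) (w : Fin M ⊕ Fin M → ℝ) :
    ∃ u : SymbolIndex M L → ℝ, (∀ p, u (i, p) = w p) ∧
      jointPrec L N₀ d h D *ᵥ u = jointEta N₀ d h E D y
        + (timeSelector M i)ᵀ *ᵥ (marginalMessage N₀ d h E D y i).grad w := by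
  obtain ⟨X, hX, hg⟩ := isMessageOf_marginalMessage (h := h) (E := E) (y := y) hN₀ hd hD i w
  refine ⟨fun a => X ((a.1 : ℕ) + 1) a.2, fun p => ?_, ?_⟩
  · rw [← hX, nodeView, nodeSlot_symbolNode]
  · rw [← sub_eq_iff_eq_add']
    ext ⟨t, p⟩
    rw [← chainGrad_localMessage i.pos hD, hg, nodeSlot_symbolNode]
    simp only [timeSelector, Matrix.mulVec, dotProduct, Matrix.transpose_apply,
      Matrix.submatrix_apply, Matrix.one_apply, id_eq, Prod.mk.injEq]
    by_cases hti : t = i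
    · subst hti
      simp
    · rw [if_neg fun h0 => hti (Fin.ext (by omega)), Finset.sum_eq_zero]
      intro q _
      rw [if_neg fun h0 => hti h0.1.symm, zero_mul]

theorem outputMean_eq_and_outputCov_eq [NeZero M] (hN₀ : 0 < N₀) (hd : ∀ k, 0 < d k)
    (hD : ∀ m, 0 < D m) (i : Fin L) :
    outputMean N₀ d h E D y i = timeSelector M i *ᵥ jointMean N₀ d h E D y ∧
    outputCov N₀ d h E D y i
      = timeSelector M i * (jointPrec L N₀ d h D)⁻¹ * (timeSelector M i)ᵀ ∧
    (outputCov N₀ d h E D y i).PosDef := by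
  have hpd := marginalMessage_posDef (h := h) (E := E) (y := y) hN₀ hd hD i
  set a := marginalMessage N₀ d h E D y i with ha
  have hdet : IsUnit a.prec.det := (Matrix.isUnit_iff_isUnit_det _).1 hpd.isUnit
  have hJ := jointPrec_posDef L hN₀ hd h hD
  have hJdet : IsUnit (jointPrec L N₀ d h D).det :=
    (Matrix.isUnit_iff_isUnit_det _).1 hJ.isUnit
  have hcov : outputCov N₀ d h E D y i = a.prec⁻¹ :=
    pinv_eq_of_mul_eq_one (Matrix.mul_nonsing_inv _ hdet)
  have hmean : outputMean N₀ d h E D y i = a.prec⁻¹ *ᵥ a.eta := by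
    rw [← hcov]; rfl
  -- The point where the marginal message has gradient `v` extends to a `u` with `J u = η + Eᵀ v`,
  -- where `E` is the time selector. Invertibility of `J` determines `u`. Then `v = 0` compares the
  -- means, and the remaining linear part in `v` compares the covariances.
  have key : ∀ v, a.prec⁻¹ *ᵥ (a.eta + v) = timeSelector M i *ᵥ (jointMean N₀ d h E D y
      + (jointPrec L N₀ d h D)⁻¹ *ᵥ ((timeSelector M i)ᵀ *ᵥ v)) := by
    intro v
    obtain ⟨u, hu, hgrad⟩ := exists_joint_of_marginalMessage (h := h) (E := E) (y := y) hN₀ hd hD i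
      (a.prec⁻¹ *ᵥ (a.eta + v))
    have hv : a.grad (a.prec⁻¹ *ᵥ (a.eta + v)) = v := by
      rw [Message.grad, Matrix.mulVec_mulVec, Matrix.mul_nonsing_inv _ hdet, Matrix.one_mulVec,
        add_sub_cancel_left]
    rw [← ha, hv] at hgrad
    have hu' : u = jointMean N₀ d h E D y
        + (jointPrec L N₀ d h D)⁻¹ *ᵥ ((timeSelector M i)ᵀ *ᵥ v) := by
      rw [jointMean, ← Matrix.mulVec_add, ← hgrad, Matrix.mulVec_mulVec,
        Matrix.nonsing_inv_mul _ hJdet, Matrix.one_mulVec]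
    rw [← hu', timeSelector_mulVec]
    exact funext fun p => (hu p).symm
  have h0 : a.prec⁻¹ *ᵥ a.eta = timeSelector M i *ᵥ jointMean N₀ d h E D y := by
    simpa using key 0
  refine ⟨hmean.trans h0, ?_, by rw [hcov]; exact hpd.inv⟩
  rw [hcov, ← Matrix.mulVec_injective.eq_iff]
  ext1 v
  have := key v
  rw [Matrix.mulVec_add, Matrix.mulVec_add, h0, add_right_inj] at this
  rw [this, Matrix.mulVec_mulVec, Matrix.mulVec_mulVec]

end Joint

end

end OAC

/-! ### The posterior laws of the symbols and of their sum -/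

theorem theorem3 {M L : ℕ} [NeZero M]
    (N₀ T : ℝ) (hN₀ : 0 < N₀)
    (τ : Fin (M + 1) → ℝ) (hτ0 : τ 0 = 0) (hτT : τ (Fin.last M) = T) (hτ : StrictMono τ)
    (h : Fin M → ℂ)
    (x : Fin L → Fin M → ℂ) (hx : ∀ m, 0 < OAC.sampleVar x m)
    {Ω : Type*} [MeasurableSpace Ω] (P : Measure Ω) [IsProbabilityMeasure P]
    (s : Fin L → Fin M → Ω → ℂ) (z y : Fin (L + 1) → Fin M → Ω → ℂ)
    (hs : ∀ i m, HasLaw (s i m)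
      (OAC.complexGaussian (OAC.sampleMean x m) (OAC.sampleVar x m)) P)
    (hz : ∀ i k, HasLaw (z i k) (OAC.complexGaussian 0 (N₀ / OAC.filterLength τ k)) P)
    (hindep : iIndepFun
      (Sum.elim (fun p : Fin L × Fin M => s p.1 p.2)
        (fun p : Fin (L + 1) × Fin M => z p.1 p.2)) P)
    (hy : ∀ i k ω, y i k ω =
      ∑ m, h m * OAC.neighbour (fun j l => s j l ω) i k m + z i k ω)
    (i : Fin L)
    (μ : (Fin (L + 1) → Fin M → ℂ) → Fin M ⊕ Fin M → ℝ)
    (hμ : μ = fun v => OAC.outputMean N₀ (OAC.filterLength τ) h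
      (OAC.sampleMean x) (OAC.sampleVar x) v i)
    (S : (Fin (L + 1) → Fin M → ℂ) → Matrix (Fin M ⊕ Fin M) (Fin M ⊕ Fin M) ℝ)
    (hS : S = fun v => OAC.outputCov N₀ (OAC.filterLength τ) h
      (OAC.sampleMean x) (OAC.sampleVar x) v i) :
    ((∀ v, (S v).PosDef) ∧
      ∀ᵐ v ∂(P.map fun ω j k => y j k ω),
        condDistrib (fun ω => OAC.realVec fun m => s i m ω) (fun ω j k => y j k ω) P v
          = multivariateGaussian (WithLp.toLp 2 (μ v)) (S v)) ∧
    ((∀ v, (OAC.sumCov (S v)).PosDef) ∧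
      ∀ᵐ v ∂(P.map fun ω j k => y j k ω),
        condDistrib (fun ω => OAC.realVec fun _ : Unit => ∑ m, s i m ω)
            (fun ω j k => y j k ω) P v
          = multivariateGaussian (WithLp.toLp 2 (OAC.sumMean (μ v))) (OAC.sumCov (S v))) := by
  have hd : ∀ k, 0 < OAC.filterLength τ k := fun k => sub_pos.2 (hτ Fin.castSucc_lt_succ)
  have hout := fun v => OAC.outputMean_eq_and_outputCov_eq (h := h) (E := OAC.sampleMean x)
    (y := v) hN₀ hd hx i
  have hSpd : ∀ v, (S v).PosDef := fun v => by rw [hS]; exact (hout v).2.2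
  have hsel : ∀ ω, OAC.timeSelector M i *ᵥ
      (fun a : OAC.SymbolIndex M L => OAC.realVec (fun m => s a.1 m ω) a.2)
      = (OAC.realVec fun m => s i m ω).ofLp := fun ω => by
    rw [OAC.timeSelector_mulVec]
  refine ⟨⟨hSpd, ?_⟩, fun v => OAC.sumCov_posDef (hSpd v), ?_⟩
  · have h1 := OAC.condDistrib_symbols hN₀ hd h hx hs hz hindep hy (OAC.timeSelector M i)
    simp only [hsel, WithLp.toLp_ofLp] at h1
    filter_upwards [h1] with v hv
    rw [hv, hμ, hS]
    simp only [(hout v).1, (hout v).2.1]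
  · have h1 := OAC.condDistrib_symbols hN₀ hd h hx hs hz hindep hy
      (OAC.sumMatrix M * OAC.timeSelector M i)
    simp only [← Matrix.mulVec_mulVec, hsel, ← OAC.realVec_sum] at h1
    filter_upwards [h1] with v hv
    rw [hv, hμ, hS]
    simp only [(hout v).1, (hout v).2.1]
    rw [← OAC.sumMatrix_mulVec, ← OAC.sumMatrix_conj, Matrix.transpose_mul]
    simp only [Matrix.mul_assoc]
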